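/- Let $M^4$ be a smooth $4$-manifold and $f\colon M\to\mathbb R^{4+r}$ ($r\ge 0$) a smooth immersion with normal spaces $N_p=(df_p(T_pM))^\perp$ and second fundamental form $\mathrm{II}(X,Y)=\pi_N\nabla_XY$. The immersion is \emph{austere} if for every $p\in M$ and $\nu\in N_p$ the eigenvalues of $\nu\cdot\mathrm{II}_p$ with respect to the induced metric are, with multiplicity, symmetric about $0$. It is of \emph{type B} if for every $p$ there is an orthonormal basis of $T_pM$ in which every form $\nu\cdot \mathrm{II}_p$, $\nu\in N_p$, has its matrix in $$\mathcal Q_B=\left\{\begin{bmatrix} mI & B\\ {}^tB & -mI\end{bmatrix} : m\in\mathbb R,\ B\in M_2(\mathbb R)\right\}.$$ Then: (1) If $f$ is austere of type B, then at no point $p\in M$ does the first normal space (the span of the values of $\mathrm{II}_p$ in $N_p$) have dimension $\delta=5$. That is, the forms $\nu\cdot\mathrm{II}_p$ never span a space conjugate to all of $\mathcal Q_B$: there are no (nonempty) austere $4$-folds of maximal type B. (2) Let $\mathscr F$ be the bundle of semi-orthonormal frames $(p;e_1,\dots,e_4;\nu_1,\dots,\nu_5)$ of $\mathbb R^9$ (the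 $e_i$ orthonormal, orthogonal to the linearly independent $\nu_a$), and define $1$-forms on $\mathscr F$ by $dp=e_i\omega^i+\nu_a\theta^a$ and $de_i=e_j\phi^j_i+\nu_a\eta^a_i$. Let $S^1,\dots,S^5$ be the basis of $\mathcal Q_B$ for which $S^1,\dots,S^4$ have $m=0$ and $B$ equal to the matrix units $E_{11},E_{12},E_{21},E_{22}$, and $S^5$ has $m=1$, $B=0$. Let $\mathcal I$ be the Pfaffian system generated by the $1$-forms $\theta^a$ and $\eta^a_i-S^a_{ij}\omega^j$. An admissible integral element of a Pfaffian system is a $4$-dimensional subspace of a tangent space of $\mathscr F$ on which the $1$-forms of the system and their exterior derivatives vanish and on which $\omega^1\wedge\omega^2\wedge\omega^3\wedge\omega^4\ne0$. Let $\mathcal J$ be the prolonged system, generated by $\mathcal I$ and all smooth $1$-forms on $\mathscr F$ that vanish on every admissible integral element of $\mathcal I$. Then $\mathcal J$ has no admissible integral elements at any point of $\mathscr F$. -/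

import Mathlib

open scoped Manifold ContDiff

noncomputable section

namespace Austere

/-- The model space of a `4`-manifold. -/
abbrev V4 : Type := EuclideanSpace ℝ (Fin 4)

/-- The space of symmetric matrices `[[m I, B], [Bᵀ, -m I]]`, with `m` a real number and `B` an
arbitrary real `2 × 2` matrix. -/
def QB : Submodule ℝ (Matrix (Fin 4) (Fin 4) ℝ) where
  carrier := {S | ∃ (m : ℝ) (B : Matrix (Fin 2) (Fin 2) ℝ),
    S = !![m, 0, B 0 0, B 0 1;
           0, m, B 1 0, B 1 1;
           B 0 0, B 1 0, -m, 0;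
           B 0 1, B 1 1, 0, -m]}
  zero_mem' := ⟨0, 0, by ext i j; fin_cases i <;> fin_cases j <;> simp⟩
  add_mem' := by
    rintro _ _ ⟨m, B, rfl⟩ ⟨m', B', rfl⟩
    refine ⟨m + m', B + B', ?_⟩
    ext i j
    fin_cases i <;> fin_cases j <;> simp [add_comm]
  smul_mem' := by
    rintro c _ ⟨m, B, rfl⟩
    refine ⟨c * m, c • B, ?_⟩
    ext i j
    fin_cases i <;> fin_cases j <;> simp

/-! ### Immersed submanifolds of dimension four in Euclidean space -/

section Submanifold

variable {r : ℕ} {M : Type*} [TopologicalSpace M] [ChartedSpace V4 M]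

/-- `f` is a smooth immersion of the `4`-manifold `M` into `ℝ^(4+r)`. -/
def IsSmoothImmersion (f : M → EuclideanSpace ℝ (Fin (4 + r))) : Prop :=
  ContMDiff (𝓡 4) 𝓘(ℝ, EuclideanSpace ℝ (Fin (4 + r))) ∞ f ∧
    ∀ p : M, Function.Injective (mfderiv (𝓡 4) 𝓘(ℝ, EuclideanSpace ℝ (Fin (4 + r))) f p)

/-- The differential of `f` at `p`, with values in `ℝ^(4+r)`. -/
def diff (f : M → EuclideanSpace ℝ (Fin (4 + r))) (p : M) :
    TangentSpace (𝓡 4) p →L[ℝ] EuclideanSpace ℝ (Fin (4 + r)) :=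
  mfderiv (𝓡 4) 𝓘(ℝ, EuclideanSpace ℝ (Fin (4 + r))) f p

/-- The normal space `N_p`: the orthogonal complement of the image of the differential. -/
def normalSpace (f : M → EuclideanSpace ℝ (Fin (4 + r))) (p : M) :
    Submodule ℝ (EuclideanSpace ℝ (Fin (4 + r))) :=
  (LinearMap.range (diff f p).toLinearMap)ᗮ

/-- The second fundamental form `II(X, Y) = π_N (∇_X Y)` at `p`. In the preferred chart at `p`
(which is the one that identifies the tangent space at `p` with `ℝ⁴`) extend `Y` to a field with
constant coefficients; then `∇_X Y` is the second derivative of `f`, read in this chart, in the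
directions `X` and `Y`. -/
def secondFundamentalForm (f : M → EuclideanSpace ℝ (Fin (4 + r))) (p : M)
    (X Y : TangentSpace (𝓡 4) p) : EuclideanSpace ℝ (Fin (4 + r)) :=
  (normalSpace f p).starProjection
    (fderiv ℝ (fderiv ℝ (f ∘ (extChartAt (𝓡 4) p).symm)) (extChartAt (𝓡 4) p p)
      (show V4 from X) (show V4 from Y))

/-- `e` is an orthonormal basis of the tangent space at `p` for the metric induced by `f`. -/
def IsOrthonormalFrame (f : M → EuclideanSpace ℝ (Fin (4 + r))) (p : M)
    (e : Fin 4 → TangentSpace (𝓡 4) p) : Prop :=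
  Orthonormal ℝ (fun i => diff f p (e i))

/-- The matrix, in the tangent frame `e`, of the quadratic form `II_ν = ν · II`. -/
def formMatrix (f : M → EuclideanSpace ℝ (Fin (4 + r))) (p : M)
    (e : Fin 4 → TangentSpace (𝓡 4) p) (ν : EuclideanSpace ℝ (Fin (4 + r))) :
    Matrix (Fin 4) (Fin 4) ℝ :=
  Matrix.of fun i j => inner ℝ ν (secondFundamentalForm f p (e i) (e j))

/-- `f` is austere: at every point and for every normal vector `ν`, the eigenvalues (with
multiplicity) of `II_ν` with respect to the induced metric are symmetric around zero. -/
def IsAustere (f : M → EuclideanSpace ℝ (Fin (4 + r))) : Prop :=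
  ∀ (p : M), ∀ ν ∈ normalSpace f p, ∀ e : Fin 4 → TangentSpace (𝓡 4) p,
    IsOrthonormalFrame f p e →
      (formMatrix f p e ν).charpoly.roots.map (fun t => -t) = (formMatrix f p e ν).charpoly.roots

/-- `f` is of type B: at every point `p` the space `{ν · II | ν ∈ N_p}` is represented, in a
suitable orthonormal basis of the tangent space at `p`, by a subspace of `QB`. -/
def IsTypeB (f : M → EuclideanSpace ℝ (Fin (4 + r))) : Prop :=
  ∀ p : M, ∃ e : Fin 4 → TangentSpace (𝓡 4) p, IsOrthonormalFrame f p e ∧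
    ∀ ν ∈ normalSpace f p, formMatrix f p e ν ∈ QB

/-- The first normal space: the image (linear span of the values) of the second fundamental
form. -/
def firstNormalSpace (f : M → EuclideanSpace ℝ (Fin (4 + r))) (p : M) :
    Submodule ℝ (EuclideanSpace ℝ (Fin (4 + r))) :=
  Submodule.span ℝ {v | ∃ X Y : TangentSpace (𝓡 4) p, v = secondFundamentalForm f p X Y}

/-- The normal rank `δ(p)`. -/
def normalRank (f : M → EuclideanSpace ℝ (Fin (4 + r))) (p : M) : ℕ :=
  Module.finrank ℝ (firstNormalSpace f p)

end Submanifold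

/-! ### The Pfaffian system on semi-orthonormal frames of `ℝ⁹` -/

/-- `ℝ⁹ = ℝ^(4+5)`. -/
abbrev V9 : Type := EuclideanSpace ℝ (Fin 9)

/-- Triples `(p, (e_1, …, e_4), (ν_1, …, ν_5))` of a point and nine vectors of `ℝ⁹`; the
semi-orthonormal frame bundle is a submanifold of this vector space. -/
abbrev FrameSpace : Type := V9 × (Fin 4 → V9) × (Fin 5 → V9)

/-- The semi-orthonormal frame bundle of `ℝ⁹`: the `e_i` are orthonormal and orthogonal to the
`ν_a`, and the `ν_a` are linearly independent. -/
def semiOrthonormalFrames : Set FrameSpace :=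
  {u | Orthonormal ℝ u.2.1 ∧ (∀ i a, inner ℝ (u.2.1 i) (u.2.2 a) = 0) ∧ LinearIndependent ℝ u.2.2}

/-- The tangent space of the semi-orthonormal frame bundle at `u`, as the kernel of the
differentials of the equations `e_i · e_j = δ_ij` and `e_i · ν_a = 0`. -/
def IsTangentToFrames (u X : FrameSpace) : Prop :=
  (∀ i j, inner ℝ (X.2.1 i) (u.2.1 j) + inner ℝ (u.2.1 i) (X.2.1 j) = 0) ∧
    ∀ i a, inner ℝ (X.2.1 i) (u.2.2 a) + inner ℝ (u.2.1 i) (X.2.2 a) = 0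

/-- Differential `1`-forms on (open parts of) the space of frames. -/
abbrev OneForm : Type := FrameSpace → FrameSpace →L[ℝ] ℝ

/-- The exterior derivative of a `1`-form at `u`, evaluated on `(X, Y)`. -/
def extDerivOneForm (α : OneForm) (u X Y : FrameSpace) : ℝ :=
  extDeriv (fun v => ContinuousAlternatingMap.ofSubsingleton ℝ FrameSpace ℝ (0 : Fin 1) (α v))
    u ![X, Y]

/-- The differential `dp` of the base point. -/
def dBase : FrameSpace →L[ℝ] V9 := ContinuousLinearMap.fst ℝ V9 ((Fin 4 → V9) × (Fin 5 → V9))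

/-- The differential `de_i` of the frame vector `e_i`. -/
def dTangent (i : Fin 4) : FrameSpace →L[ℝ] V9 :=
  (ContinuousLinearMap.proj (R := ℝ) (φ := fun _ : Fin 4 => V9) i).comp
    ((ContinuousLinearMap.fst ℝ (Fin 4 → V9) (Fin 5 → V9)).comp
      (ContinuousLinearMap.snd ℝ V9 ((Fin 4 → V9) × (Fin 5 → V9))))

/-- The metric coefficients `g_ab = ν_a · ν_b`. -/
def metricMatrix (u : FrameSpace) : Matrix (Fin 5) (Fin 5) ℝ :=
  Matrix.of fun a b => inner ℝ (u.2.2 a) (u.2.2 b)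

/-- The canonical form `ω^i`, the `e_i`-component of `dp`. -/
def omegaForm (i : Fin 4) : OneForm := fun u => (innerSL ℝ (u.2.1 i)).comp dBase

/-- The canonical form `θ^a`, the `ν_a`-component of `dp`. -/
def thetaForm (a : Fin 5) : OneForm := fun u =>
  ∑ b, (metricMatrix u)⁻¹ a b • (innerSL ℝ (u.2.2 b)).comp dBase

/-- The connection form `η^a_i`, the `ν_a`-component of `de_i`. -/
def etaForm (a : Fin 5) (i : Fin 4) : OneForm := fun u =>
  ∑ b, (metricMatrix u)⁻¹ a b • (innerSL ℝ (u.2.2 b)).comp (dTangent i)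

/-- The basis `S^1, …, S^5` of `QB`: `m = 0` and `B` a matrix unit for the first four, `m = 1` and
`B = 0` for the last. -/
def basisQB : Fin 5 → Matrix (Fin 4) (Fin 4) ℝ :=
  ![!![0, 0, 1, 0; 0, 0, 0, 0; 1, 0, 0, 0; 0, 0, 0, 0],
    !![0, 0, 0, 1; 0, 0, 0, 0; 0, 0, 0, 0; 1, 0, 0, 0],
    !![0, 0, 0, 0; 0, 0, 1, 0; 0, 1, 0, 0; 0, 0, 0, 0],
    !![0, 0, 0, 0; 0, 0, 0, 1; 0, 0, 0, 0; 0, 1, 0, 0],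
    !![1, 0, 0, 0; 0, 1, 0, 0; 0, 0, -1, 0; 0, 0, 0, -1]]

/-- The generators of the standard system `{θ^a, η^a_i - S^a_ij ω^j}` for `QB`. -/
def standardSystem : Set OneForm :=
  {α | (∃ a, α = thetaForm a) ∨
    ∃ a i, α = fun u => etaForm a i u - ∑ j, basisQB a i j • omegaForm j u}

/-- `E` is an admissible integral element at `u` of the Pfaffian system generated by the `1`-forms
in `𝓘`: a `4`-plane tangent to the semi-orthonormal frame bundle on which the forms in `𝓘` and
their exterior derivatives vanish, and which satisfies the independence condition
`ω^1 ∧ ω^2 ∧ ω^3 ∧ ω^4 ≠ 0`. -/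
def IsAdmissibleIntegralElement (𝓘 : Set OneForm) (u : FrameSpace)
    (E : Submodule ℝ FrameSpace) : Prop :=
  Module.finrank ℝ E = 4 ∧
  (∀ X ∈ E, IsTangentToFrames u X) ∧
  (∀ X ∈ E, (∀ i, omegaForm i u X = 0) → X = 0) ∧
  ∀ α ∈ 𝓘, (∀ X ∈ E, α u X = 0) ∧ ∀ X ∈ E, ∀ Y ∈ E, extDerivOneForm α u X Y = 0

/-- The prolonged system: the system enlarged by all smooth `1`-forms that vanish on every
admissible integral element of the standard system. (It contains the standard system.) -/
def prolongedSystem : Set OneForm :=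
  {α | (∀ u ∈ semiOrthonormalFrames, ContDiffAt ℝ ∞ α u) ∧
    ∀ u ∈ semiOrthonormalFrames, ∀ E : Submodule ℝ FrameSpace,
      IsAdmissibleIntegralElement standardSystem u E → ∀ X ∈ E, α u X = 0}

end Austere

end

open scoped Manifold ContDiff

noncomputable section

namespace Austere

/-! ### Linear and quadratic algebra of the structure equations -/

/-! Both statements reduce to one contradiction in Cartan's structure equations. Indices below start
at 0, as in the code. Take a tangent frame `e_i`, a normal frame `n_a` with second fundamental form
`S^a n_a`, and connection forms `φ^j_i`, `κ^a_b`.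

Setting the exterior derivatives of `η^a_i - S^a_ij ω^j` to zero gives linear equations between the
coefficients of `φ` and `κ`. They force three identities of 1-forms: `κ^4_0 = 2φ^0_2`, `κ^4_3 =
2φ^1_3` and `κ^1_0 - κ^2_3 = -2φ^2_3` (`connection_relations`). Now differentiate these and evaluate
`dφ`, `dκ` by the structure equations, on `(e_0, e_2)`, `(e_1, e_3)` and `(e_2, e_3)` respectively.
In the sum of the first two results minus twice the third, the terms quadratic in the connection and
the coefficient `g_44` cancel. What remains is a multiple of `g_00 + g_33 = |n_0|² + |n_3|²`, which
would have to vanish (`normalMetric_trace_eq_zero`, `FrameJet.not_isIntegral`). `FrameJet` isolates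
the pointwise data that this argument uses.

On the frame bundle, the three identities hold on every admissible integral element, so the
corresponding smooth 1-forms belong to the prolonged system. An integral element of that system must
also annihilate their exterior derivatives, which is the contradiction.

For an immersion there are two further points. First, the codimension may exceed 5, so it must be
shown that the derivatives of the `n_a` stay in the span of the frame. This follows from the
vanishing of the first prolongation of `QB` (`prolongation_QB_eq_zero`). Second, type B supplies a
frame at each point with no continuity in the point. Where the rank is 5, the space of shape
operators determines the involution `diag(I, -I)` up to sign by an algebraic formula (`splitting`).
Hence the orthogonal splitting of the tangent space into two planes is locally smooth, and
Gram–Schmidt in each plane yields a smooth adapted frame (`exists_smooth_adaptedFrame`). -/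

/-- The coefficients of the exterior derivative of `η^a_i - S^a_ij ω^j`: the connection
coefficients `φ j i l = φ^j_i(e_l)` and `κ b l = κ^a_b(e_l)` define an integral element if and only
if this expression is symmetric in `k` and `l`. -/
def structureDefect (φ : Fin 4 → Fin 4 → Fin 4 → ℝ) (κ : Fin 5 → Fin 4 → ℝ) (a : Fin 5)
    (i k l : Fin 4) : ℝ :=
  ∑ j, (φ j i l * basisQB a j k + basisQB a i j * φ j k l) - ∑ b, basisQB b i k * κ b l

/-- The value on `(e_l, e_k)` of `dφ^j_i` given by the structure equations. -/
def curvTangent (φ : Fin 4 → Fin 4 → Fin 4 → ℝ) (g : Fin 5 → Fin 5 → ℝ) (j i l k : Fin 4) : ℝ :=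
  ∑ m, (φ m j l * φ m i k - φ m j k * φ m i l) +
    ∑ a, ∑ b, g a b * (basisQB a j l * basisQB b i k - basisQB a j k * basisQB b i l)

/-- The value on `(e_l, e_k)` of `dκ^a_b` given by the structure equations. -/
def curvNormal (κ : Fin 5 → Fin 5 → Fin 4 → ℝ) (g : Fin 5 → Fin 5 → ℝ) (a b : Fin 5)
    (l k : Fin 4) : ℝ :=
  ∑ c, (κ a c k * κ c b l - κ a c l * κ c b k) +
    ∑ i, ∑ c, g b c * (basisQB a i l * basisQB c i k - basisQB a i k * basisQB c i l)

variable {φ : Fin 4 → Fin 4 → Fin 4 → ℝ}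

/-- Antisymmetry of `φ` leaves a linear system for one row of `κ`, with one equation for each `i`
and each pair `k < l`. This lemma and its companions for the other rows solve for the entries that
enter the relations below and their derivatives. -/
theorem normalConnection_row_zero {κ : Fin 5 → Fin 4 → ℝ}
    (hφ : ∀ i j l, φ i j l = -φ j i l)
    (h : ∀ i k l, structureDefect φ κ 0 i k l = structureDefect φ κ 0 i l k) :
    κ 0 0 = 2 * φ 0 2 2 + φ 0 3 3 ∧
    κ 0 2 = -2 * φ 0 2 0 - φ 1 2 1 ∧
    κ 0 3 = -φ 0 3 0 ∧
    κ 3 1 = -2 * φ 0 2 3 + φ 0 3 2 ∧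
    κ 3 2 = -φ 0 3 1 ∧
    κ 3 3 = 2 * φ 0 2 1 - φ 1 2 0 := by
  have diag : ∀ i l, φ i i l = 0 := fun i l => by linarith [hφ i i l]
  have H : ∀ i, _ ∧ _ ∧ _ ∧ _ ∧ _ ∧ _ := fun i =>
    ⟨h i 0 1, h i 0 2, h i 0 3, h i 1 2, h i 1 3, h i 2 3⟩
  have H0 := H 0
  have H1 := H 1
  have H2 := H 2
  have H3 := H 3
  clear H h
  simp [structureDefect, Fin.sum_univ_four, Fin.sum_univ_five, basisQB, diag, hφ 1 0, hφ 2 0,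
    hφ 3 0, hφ 2 1, hφ 3 1, hφ 3 2] at H0 H1 H2 H3
  obtain ⟨_, _, _, _, _, _⟩ := H0
  obtain ⟨_, _, _, _, _, _⟩ := H1
  obtain ⟨_, _, _, _, _, _⟩ := H2
  obtain ⟨_, _, _, _, _, _⟩ := H3
  refine ⟨?_, ?_, ?_, ?_, ?_, ?_⟩ <;> linarith

theorem normalConnection_row_one {κ : Fin 5 → Fin 4 → ℝ}
    (hφ : ∀ i j l, φ i j l = -φ j i l)
    (h : ∀ i k l, structureDefect φ κ 1 i k l = structureDefect φ κ 1 i l k) :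
    κ 0 0 = φ 0 2 3 - φ 2 3 0 ∧
    κ 0 1 = φ 1 3 2 - φ 2 3 1 ∧
    κ 0 2 = -φ 1 3 1 - φ 2 3 2 ∧
    κ 0 3 = -φ 0 2 0 - φ 2 3 3 ∧
    κ 1 2 = -φ 0 2 0 ∧
    κ 1 3 = -2 * φ 0 3 0 - φ 1 3 1 ∧
    κ 2 2 = 2 * φ 0 3 1 - φ 1 3 0 ∧
    κ 2 3 = -φ 0 2 1 ∧
    κ 3 1 = φ 0 1 1 + φ 0 2 2 ∧
    κ 3 2 = φ 0 1 2 - φ 0 2 1 ∧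
    κ 3 3 = φ 0 1 3 - φ 1 3 0 ∧
    κ 4 2 = φ 0 2 3 - 2 * φ 0 3 2 ∧
    κ 4 3 = φ 0 2 2 := by
  have diag : ∀ i l, φ i i l = 0 := fun i l => by linarith [hφ i i l]
  have H : ∀ i, _ ∧ _ ∧ _ ∧ _ ∧ _ ∧ _ := fun i =>
    ⟨h i 0 1, h i 0 2, h i 0 3, h i 1 2, h i 1 3, h i 2 3⟩
  have H0 := H 0
  have H1 := H 1
  have H2 := H 2
  have H3 := H 3
  clear H h
  simp [structureDefect, Fin.sum_univ_four, Fin.sum_univ_five, basisQB, diag, hφ 1 0, hφ 2 0,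
    hφ 3 0, hφ 2 1, hφ 3 1, hφ 3 2] at H0 H1 H2 H3
  obtain ⟨_, _, _, _, _, _⟩ := H0
  obtain ⟨_, _, _, _, _, _⟩ := H1
  obtain ⟨_, _, _, _, _, _⟩ := H2
  obtain ⟨_, _, _, _, _, _⟩ := H3
  refine ⟨?_, ?_, ?_, ?_, ?_, ?_, ?_, ?_, ?_, ?_, ?_, ?_, ?_⟩ <;> linarith

theorem normalConnection_row_two {κ : Fin 5 → Fin 4 → ℝ}
    (hφ : ∀ i j l, φ i j l = -φ j i l)
    (h : ∀ i k l, structureDefect φ κ 2 i k l = structureDefect φ κ 2 i l k) :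
    κ 0 0 = -φ 0 1 0 + φ 1 3 3 ∧
    κ 0 2 = -φ 0 1 2 - φ 0 2 1 ∧
    κ 0 3 = -φ 0 1 3 - φ 1 3 0 ∧
    κ 1 2 = -φ 1 3 0 ∧
    κ 1 3 = -φ 0 2 1 + 2 * φ 1 2 0 ∧
    κ 2 2 = -φ 0 2 0 - 2 * φ 1 2 1 ∧
    κ 2 3 = -φ 1 3 1 ∧
    κ 3 0 = φ 0 2 3 + φ 2 3 0 ∧
    κ 3 1 = φ 1 3 2 + φ 2 3 1 ∧
    κ 3 2 = -φ 1 3 1 + φ 2 3 2 ∧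
    κ 3 3 = -φ 0 2 0 + φ 2 3 3 ∧
    κ 4 2 = φ 1 3 3 ∧
    κ 4 3 = -2 * φ 1 2 3 + φ 1 3 2 := by
  have diag : ∀ i l, φ i i l = 0 := fun i l => by linarith [hφ i i l]
  have H : ∀ i, _ ∧ _ ∧ _ ∧ _ ∧ _ ∧ _ := fun i =>
    ⟨h i 0 1, h i 0 2, h i 0 3, h i 1 2, h i 1 3, h i 2 3⟩
  have H0 := H 0
  have H1 := H 1
  have H2 := H 2
  have H3 := H 3
  clear H h
  simp [structureDefect, Fin.sum_univ_four, Fin.sum_univ_five, basisQB, diag, hφ 1 0, hφ 2 0,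
    hφ 3 0, hφ 2 1, hφ 3 1, hφ 3 2] at H0 H1 H2 H3
  obtain ⟨_, _, _, _, _, _⟩ := H0
  obtain ⟨_, _, _, _, _, _⟩ := H1
  obtain ⟨_, _, _, _, _, _⟩ := H2
  obtain ⟨_, _, _, _, _, _⟩ := H3
  refine ⟨?_, ?_, ?_, ?_, ?_, ?_, ?_, ?_, ?_, ?_, ?_, ?_, ?_⟩ <;> linarith

theorem normalConnection_row_three {κ : Fin 5 → Fin 4 → ℝ}
    (hφ : ∀ i j l, φ i j l = -φ j i l)
    (h : ∀ i k l, structureDefect φ κ 3 i k l = structureDefect φ κ 3 i l k) :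
    κ 0 0 = φ 1 2 3 - 2 * φ 1 3 2 ∧
    κ 0 2 = -φ 0 3 1 + 2 * φ 1 3 0 ∧
    κ 0 3 = -φ 1 2 0 ∧
    κ 3 1 = φ 1 2 2 + 2 * φ 1 3 3 ∧
    κ 3 2 = -φ 1 2 1 ∧
    κ 3 3 = -φ 0 3 0 - 2 * φ 1 3 1 := by
  have diag : ∀ i l, φ i i l = 0 := fun i l => by linarith [hφ i i l]
  have H : ∀ i, _ ∧ _ ∧ _ ∧ _ ∧ _ ∧ _ := fun i =>
    ⟨h i 0 1, h i 0 2, h i 0 3, h i 1 2, h i 1 3, h i 2 3⟩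
  have H0 := H 0
  have H1 := H 1
  have H2 := H 2
  have H3 := H 3
  clear H h
  simp [structureDefect, Fin.sum_univ_four, Fin.sum_univ_five, basisQB, diag, hφ 1 0, hφ 2 0,
    hφ 3 0, hφ 2 1, hφ 3 1, hφ 3 2] at H0 H1 H2 H3
  obtain ⟨_, _, _, _, _, _⟩ := H0
  obtain ⟨_, _, _, _, _, _⟩ := H1
  obtain ⟨_, _, _, _, _, _⟩ := H2
  obtain ⟨_, _, _, _, _, _⟩ := H3
  refine ⟨?_, ?_, ?_, ?_, ?_, ?_⟩ <;> linarith

theorem normalConnection_row_four {κ : Fin 5 → Fin 4 → ℝ}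
    (hφ : ∀ i j l, φ i j l = -φ j i l)
    (h : ∀ i k l, structureDefect φ κ 4 i k l = structureDefect φ κ 4 i l k) :
    κ 0 0 = 2 * φ 0 2 0 ∧
    κ 0 1 = 2 * φ 0 2 1 ∧
    κ 0 2 = 2 * φ 0 2 2 ∧
    κ 0 3 = 2 * φ 0 2 3 ∧
    κ 1 0 = 2 * φ 0 3 0 ∧
    κ 1 1 = 2 * φ 0 3 1 ∧
    κ 1 2 = 2 * φ 0 3 2 ∧
    κ 1 3 = 2 * φ 0 3 3 ∧
    κ 2 0 = 2 * φ 1 2 0 ∧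
    κ 2 1 = 2 * φ 1 2 1 ∧
    κ 2 2 = 2 * φ 1 2 2 ∧
    κ 2 3 = 2 * φ 1 2 3 ∧
    κ 3 0 = 2 * φ 1 3 0 ∧
    κ 3 1 = 2 * φ 1 3 1 ∧
    κ 3 2 = 2 * φ 1 3 2 ∧
    κ 3 3 = 2 * φ 1 3 3 ∧
    κ 4 0 = 0 ∧
    κ 4 1 = 0 ∧
    κ 4 2 = 0 ∧
    κ 4 3 = 0 := by
  have diag : ∀ i l, φ i i l = 0 := fun i l => by linarith [hφ i i l]
  have H : ∀ i, _ ∧ _ ∧ _ ∧ _ ∧ _ ∧ _ := fun i =>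
    ⟨h i 0 1, h i 0 2, h i 0 3, h i 1 2, h i 1 3, h i 2 3⟩
  have H0 := H 0
  have H1 := H 1
  have H2 := H 2
  have H3 := H 3
  clear H h
  simp [structureDefect, Fin.sum_univ_four, Fin.sum_univ_five, basisQB, diag, hφ 1 0, hφ 2 0,
    hφ 3 0, hφ 2 1, hφ 3 1, hφ 3 2] at H0 H1 H2 H3
  obtain ⟨_, _, _, _, _, _⟩ := H0
  obtain ⟨_, _, _, _, _, _⟩ := H1
  obtain ⟨_, _, _, _, _, _⟩ := H2
  obtain ⟨_, _, _, _, _, _⟩ := H3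
  refine ⟨?_, ?_, ?_, ?_, ?_, ?_, ?_, ?_, ?_, ?_, ?_, ?_, ?_, ?_, ?_, ?_, ?_, ?_, ?_, ?_⟩ <;> linarith

/-! ### The three connection relations and the obstruction to differentiating them -/

section algebra

variable {φ : Fin 4 → Fin 4 → Fin 4 → ℝ} {κ : Fin 5 → Fin 5 → Fin 4 → ℝ}

/-- The relations between the connection coefficients that have constant coefficients. -/
theorem connection_relations (hφ : ∀ i j l, φ i j l = -φ j i l)
    (h : ∀ a i k l, structureDefect φ (κ a) a i k l = structureDefect φ (κ a) a i l k) (l : Fin 4) :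
    κ 4 0 l = 2 * φ 0 2 l ∧ κ 4 3 l = 2 * φ 1 3 l ∧ κ 1 0 l - κ 2 3 l = -2 * φ 2 3 l := by
  have h1 := normalConnection_row_one hφ (h 1)
  have h2 := normalConnection_row_two hφ (h 2)
  have h4 := normalConnection_row_four hφ (h 4)
  casesm* _ ∧ _
  fin_cases l <;> refine ⟨?_, ?_, ?_⟩ <;> simp only [Fin.zero_eta, Fin.mk_one, Fin.reduceFinMk] <;>
    linarith

/-- The hypotheses are the derivatives of the three relations of `connection_relations`. Their
metric parts, left side minus right, are `4 g_00 + 2 g_44`, `4 g_33 + 2 g_44` and `-g_00 - g_33 + 2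
g_44`. The first plus the second minus twice the third leaves `6 (g_00 + g_33)`; once the row
formulas are substituted, the quadratic terms in `φ` cancel in the same combination. -/
theorem normalMetric_trace_eq_zero {g : Fin 5 → Fin 5 → ℝ} (hg : ∀ a b, g a b = g b a)
    (hφ : ∀ i j l, φ i j l = -φ j i l)
    (h : ∀ a i k l, structureDefect φ (κ a) a i k l = structureDefect φ (κ a) a i l k)
    (h₁ : curvNormal κ g 4 0 0 2 = 2 * curvTangent φ g 0 2 0 2)
    (h₂ : curvNormal κ g 4 3 1 3 = 2 * curvTangent φ g 1 3 1 3)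
    (h₃ : curvNormal κ g 1 0 2 3 - curvNormal κ g 2 3 2 3 = -2 * curvTangent φ g 2 3 2 3) :
    g 0 0 + g 3 3 = 0 := by
  have h0 := normalConnection_row_zero hφ (h 0)
  have h1 := normalConnection_row_one hφ (h 1)
  have h2 := normalConnection_row_two hφ (h 2)
  have h3 := normalConnection_row_three hφ (h 3)
  have h4 := normalConnection_row_four hφ (h 4)
  have diag : ∀ i l, φ i i l = 0 := fun i l => by linarith [hφ i i l]
  have p10 := hφ 1 0
  have p20 := hφ 2 0
  have p30 := hφ 3 0
  have p21 := hφ 2 1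
  have p31 := hφ 3 1
  have p32 := hφ 3 2
  clear h hφ
  revert hg
  casesm* _ ∧ _
  simp [curvNormal, curvTangent, Fin.sum_univ_four, Fin.sum_univ_five, basisQB, *] at h₁ h₂ h₃
  intro hg
  linarith [hg 0 3, hg 1 2, hg 0 4, hg 1 4, hg 2 4, hg 3 4, hg 0 1, hg 0 2, hg 1 3, hg 2 3]

/-- The first prolongation of `QB` vanishes. -/
theorem prolongation_QB_eq_zero {κ : Fin 5 → Fin 4 → ℝ}
    (h : ∀ i k l, ∑ b, basisQB b i k * κ b l = ∑ b, basisQB b i l * κ b k) (b : Fin 5)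
    (l : Fin 4) : κ b l = 0 := by
  have H : ∀ i, _ ∧ _ ∧ _ ∧ _ ∧ _ ∧ _ := fun i =>
    ⟨h i 0 1, h i 0 2, h i 0 3, h i 1 2, h i 1 3, h i 2 3⟩
  have H0 := H 0
  have H1 := H 1
  have H2 := H 2
  have H3 := H 3
  clear H h
  simp [Fin.sum_univ_five, basisQB] at H0 H1 H2 H3
  casesm* _ ∧ _
  fin_cases b <;> fin_cases l <;> simp only [Fin.zero_eta, Fin.mk_one, Fin.reduceFinMk] <;> linarith

end algebra

/-! ### First-order data of an adapted frame -/

/-- The first-order data at a point of a frame `(e, n)` adapted to a submanifold with second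
fundamental form `S^a n_a`: the vectors `De i l`, `Dn b l`, `Dd a l` are the derivatives of the
tangent frame `e`, the normal frame `n` and its dual frame `d` in the direction of `e_l`. -/
structure FrameJet (W : Type*) [NormedAddCommGroup W] [InnerProductSpace ℝ W] where
  e : Fin 4 → W
  n : Fin 5 → W
  d : Fin 5 → W
  De : Fin 4 → Fin 4 → W
  Dn : Fin 5 → Fin 4 → W
  Dd : Fin 5 → Fin 4 → W
  orthonormal : Orthonormal ℝ e
  inner_e_n : ∀ i a, inner ℝ (e i) (n a) = 0
  inner_d_e : ∀ a i, inner ℝ (d a) (e i) = 0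
  inner_d_n : ∀ a b, inner ℝ (d a) (n b) = if a = b then 1 else 0
  deriv_e_e : ∀ i j l, inner ℝ (De i l) (e j) + inner ℝ (e i) (De j l) = 0
  deriv_e_n : ∀ i b l, inner ℝ (De i l) (n b) + inner ℝ (e i) (Dn b l) = 0
  deriv_d_e : ∀ a i l, inner ℝ (Dd a l) (e i) + inner ℝ (d a) (De i l) = 0
  deriv_d_n : ∀ a b l, inner ℝ (Dd a l) (n b) + inner ℝ (d a) (Dn b l) = 0
  De_eq : ∀ i l, De i l = ∑ j, inner ℝ (e j) (De i l) • e j + ∑ a, basisQB a i l • n a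

/-! ### Structure equations for the first-order data of a frame -/

namespace FrameJet

variable {W : Type*} [NormedAddCommGroup W] [InnerProductSpace ℝ W] (J : FrameJet W)

/-- The connection coefficients `φ^j_i(e_l)`. -/
def phi (j i l : Fin 4) : ℝ := inner ℝ (J.e j) (J.De i l)

/-- The connection coefficients `κ^a_b(e_l)`. -/
def kappa (a b : Fin 5) (l : Fin 4) : ℝ := inner ℝ (J.d a) (J.Dn b l)

/-- The metric coefficients `n_a · n_b`. -/
def metric (a b : Fin 5) : ℝ := inner ℝ (J.n a) (J.n b)

/-- The derivatives of the normal frame are combinations of the frame vectors. -/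
def IsClosed : Prop :=
  ∀ b l, J.Dn b l = ∑ a, J.kappa a b l • J.n a + ∑ i, (inner ℝ (J.e i) (J.Dn b l) : ℝ) • J.e i

/-- The exterior derivatives of the forms `η^a_i - S^a_ij ω^j` vanish. -/
def IsIntegral : Prop :=
  ∀ a i l k, (inner ℝ (J.Dd a l) (J.De i k) - inner ℝ (J.Dd a k) (J.De i l) : ℝ) =
    ∑ j, basisQB a i j * (inner ℝ (J.De j l) (J.e k) - inner ℝ (J.De j k) (J.e l))

theorem metric_comm (a b : Fin 5) : J.metric a b = J.metric b a := real_inner_comm _ _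

theorem phi_skew (i j l : Fin 4) : J.phi i j l = -J.phi j i l := by
  have := J.deriv_e_e i j l
  rw [real_inner_comm] at this
  unfold phi
  linarith

theorem inner_De_e (i j l : Fin 4) : inner ℝ (J.De i l) (J.e j) = J.phi j i l :=
  real_inner_comm _ _

theorem De_eq' (i l : Fin 4) :
    J.De i l = ∑ j, J.phi j i l • J.e j + ∑ a, basisQB a i l • J.n a := J.De_eq i l

theorem inner_De (v : W) (i l : Fin 4) : inner ℝ v (J.De i l) =
    ∑ j, J.phi j i l * inner ℝ v (J.e j) + ∑ a, basisQB a i l * inner ℝ v (J.n a) := by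
  conv_lhs => rw [De_eq']
  simp only [inner_add_right, inner_sum, real_inner_smul_right]

theorem inner_n_e (a : Fin 5) (i : Fin 4) : inner ℝ (J.n a) (J.e i) = 0 := by
  rw [real_inner_comm, J.inner_e_n]

theorem inner_De_n (i l : Fin 4) (b : Fin 5) :
    inner ℝ (J.De i l) (J.n b) = ∑ a, J.metric b a * basisQB a i l := by
  rw [real_inner_comm, inner_De]
  simp [metric, mul_comm, J.inner_n_e]

theorem inner_d_De (a : Fin 5) (i l : Fin 4) : inner ℝ (J.d a) (J.De i l) = basisQB a i l := by
  rw [inner_De]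
  simp [J.inner_d_e, J.inner_d_n]

theorem inner_Dd_n (a b : Fin 5) (l : Fin 4) : inner ℝ (J.Dd a l) (J.n b) = -J.kappa a b l :=
  eq_neg_of_add_eq_zero_left (J.deriv_d_n a b l)

theorem inner_Dd_e (a : Fin 5) (i l : Fin 4) :
    inner ℝ (J.Dd a l) (J.e i) = -basisQB a i l := by
  rw [← J.inner_d_De]
  exact eq_neg_of_add_eq_zero_left (J.deriv_d_e a i l)

theorem inner_e_Dn (i l : Fin 4) (b : Fin 5) :
    inner ℝ (J.e i) (J.Dn b l) = -∑ a, J.metric b a * basisQB a i l := by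
  rw [← J.inner_De_n]
  exact eq_neg_of_add_eq_zero_right (J.deriv_e_n i b l)

/-- This rewrites `dη^a_i = S^a_ij dω^j` in coefficients: `De` is expanded in the frame, and the
pairings of `Dd` with the frame are minus those of `d` with `De` and `Dn`. -/
theorem structureDefect_symm (h : J.IsIntegral) (a : Fin 5) (i k l : Fin 4) :
    structureDefect J.phi (J.kappa a) a i k l = structureDefect J.phi (J.kappa a) a i l k := by
  have key := h a i l k
  simp only [inner_De _ (J.Dd _ _), inner_Dd_n, inner_Dd_e, inner_De_e, mul_neg,
    Finset.sum_neg_distrib, mul_sub, Finset.sum_sub_distrib] at key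
  have e1 : ∀ l k, ∑ j, basisQB a i j * J.phi k j l = -∑ j, basisQB a i j * J.phi j k l :=
    fun l k => by
      rw [← Finset.sum_neg_distrib]
      exact Finset.sum_congr rfl fun j _ => by rw [J.phi_skew k j]; ring
  rw [e1, e1] at key
  simp only [structureDefect, Finset.sum_add_distrib]
  linarith

/-- Gauss equation. Since `φ^j_i = ⟨e_j, de_i⟩`, the left side is `dφ^j_i` on `(e_l, e_k)`;
expanding both factors in the frame gives the connection terms and the metric terms. -/
theorem curvTangent_eq (j i l k : Fin 4) :
    (inner ℝ (J.De j l) (J.De i k) - inner ℝ (J.De j k) (J.De i l) : ℝ) =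
      curvTangent J.phi J.metric j i l k := by
  rw [inner_De, inner_De]
  simp only [inner_De_e, inner_De_n, curvTangent]
  simp only [mul_sub, Finset.sum_sub_distrib, Finset.mul_sum]
  rw [Finset.sum_comm (f := fun a b => J.metric a b * (basisQB a j l * basisQB b i k)),
    Finset.sum_comm (f := fun a b => J.metric a b * (basisQB a j k * basisQB b i l))]
  have : ∀ l k, ∑ x, ∑ y, basisQB x i k * (J.metric x y * basisQB y j l) =
      ∑ y, ∑ x, J.metric x y * (basisQB x j l * basisQB y i k) := fun l k =>
    Finset.sum_congr rfl fun x _ => Finset.sum_congr rfl fun y _ => by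
      rw [J.metric_comm x y]; ring
  rw [this, this]
  simp only [mul_comm (J.phi _ i _)]
  ring

/-- Ricci equation, from `κ^a_b = ⟨d^a, dn_b⟩`. `IsClosed` is essential: a component of `Dn` outside
the span of the frame would contribute a further term. -/
theorem curvNormal_eq (h : J.IsClosed) (a b : Fin 5) (l k : Fin 4) :
    (inner ℝ (J.Dd a l) (J.Dn b k) - inner ℝ (J.Dd a k) (J.Dn b l) : ℝ) =
      curvNormal J.kappa J.metric a b l k := by
  have key : ∀ l k, (inner ℝ (J.Dd a l) (J.Dn b k) : ℝ) = -∑ c, J.kappa a c l * J.kappa c b k +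
      ∑ i, ∑ c, J.metric b c * (basisQB a i l * basisQB c i k) := fun l k => by
    rw [h b k]
    simp only [inner_add_right, inner_sum, real_inner_smul_right, inner_Dd_n, inner_Dd_e,
      inner_e_Dn, mul_neg, neg_mul, neg_neg, Finset.sum_neg_distrib, Finset.sum_mul]
    congr 1
    · simp only [mul_comm]
    · exact Finset.sum_congr rfl fun i _ => Finset.sum_congr rfl fun c _ => by ring
  rw [key, key, curvNormal]
  simp only [mul_sub, Finset.sum_sub_distrib]
  ring

theorem n_ne_zero (a : Fin 5) : J.n a ≠ 0 := fun h => by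
  have := J.inner_d_n a a
  simp [h] at this

/-- The relations between the connection forms that hold on integral elements cannot be
differentiated. -/
theorem not_isIntegral (hc : J.IsClosed) (h : J.IsIntegral)
    (h₁ : (inner ℝ (J.Dd 4 0) (J.Dn 0 2) - inner ℝ (J.Dd 4 2) (J.Dn 0 0) : ℝ) =
      2 * (inner ℝ (J.De 0 0) (J.De 2 2) - inner ℝ (J.De 0 2) (J.De 2 0)))
    (h₂ : (inner ℝ (J.Dd 4 1) (J.Dn 3 3) - inner ℝ (J.Dd 4 3) (J.Dn 3 1) : ℝ) =
      2 * (inner ℝ (J.De 1 1) (J.De 3 3) - inner ℝ (J.De 1 3) (J.De 3 1)))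
    (h₃ : (inner ℝ (J.Dd 1 2) (J.Dn 0 3) - inner ℝ (J.Dd 1 3) (J.Dn 0 2) -
        (inner ℝ (J.Dd 2 2) (J.Dn 3 3) - inner ℝ (J.Dd 2 3) (J.Dn 3 2)) : ℝ) =
      -2 * (inner ℝ (J.De 2 2) (J.De 3 3) - inner ℝ (J.De 2 3) (J.De 3 2))) : False := by
  rw [J.curvNormal_eq hc, J.curvTangent_eq] at h₁ h₂
  rw [J.curvNormal_eq hc, J.curvNormal_eq hc, J.curvTangent_eq] at h₃
  have key := normalMetric_trace_eq_zero J.metric_comm J.phi_skew (J.structureDefect_symm h)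
    h₁ h₂ h₃
  have h0 : 0 < J.metric 0 0 := real_inner_self_pos.2 (J.n_ne_zero 0)
  have h3 : 0 < J.metric 3 3 := real_inner_self_pos.2 (J.n_ne_zero 3)
  linarith

end FrameJet

/-! ### Inverse matrices and dual frames -/

section DualFrame

open scoped Topology

theorem contDiffAt_matrix_det {ι E : Type*} [Fintype ι] [DecidableEq ι] [NormedAddCommGroup E]
    [NormedSpace ℝ E] {A : E → Matrix ι ι ℝ} {x : E} {k : WithTop ℕ∞}
    (hA : ∀ i j, ContDiffAt ℝ k (fun y => A y i j) x) : ContDiffAt ℝ k (fun y => (A y).det) x := by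
  simp only [Matrix.det_apply']
  exact ContDiffAt.sum fun σ _ => contDiffAt_const.mul (contDiffAt_prod fun i _ => hA _ _)

theorem contDiffAt_matrix_inv {ι E : Type*} [Fintype ι] [DecidableEq ι] [NormedAddCommGroup E]
    [NormedSpace ℝ E] {A : E → Matrix ι ι ℝ} {x : E} {k : WithTop ℕ∞}
    (hA : ∀ i j, ContDiffAt ℝ k (fun y => A y i j) x) (h : (A x).det ≠ 0) (i j : ι) :
    ContDiffAt ℝ k (fun y => (A y)⁻¹ i j) x := by
  simp only [Matrix.inv_def, Ring.inverse_eq_inv', Matrix.smul_apply, Matrix.adjugate_apply]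
  refine ((contDiffAt_matrix_det hA).inv h).smul (contDiffAt_matrix_det fun a b => ?_)
  simp only [Matrix.updateRow_apply]
  split_ifs
  · exact contDiffAt_const
  · exact hA _ _

variable {ι W : Type*} [Fintype ι] [DecidableEq ι] [NormedAddCommGroup W]
  [InnerProductSpace ℝ W]

/-- The frame of the span of `n` dual to `n`. -/
def dualFrame (n : ι → W) (a : ι) : W := ∑ b, (Matrix.gram ℝ n)⁻¹ a b • n b

theorem det_gram_ne_zero {n : ι → W} (hn : LinearIndependent ℝ n) :
    (Matrix.gram ℝ n).det ≠ 0 :=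
  ((Matrix.posSemidef_gram ℝ n).posDef_iff_det_ne_zero).1 (Matrix.posDef_gram_of_linearIndependent hn)

theorem inner_dualFrame {n : ι → W} (a : ι) (w : W) :
    inner ℝ (dualFrame n a) w = ∑ b, (Matrix.gram ℝ n)⁻¹ a b * inner ℝ (n b) w := by
  simp [dualFrame, sum_inner, real_inner_smul_left]

theorem inner_dualFrame_self {n : ι → W} (hn : LinearIndependent ℝ n) (a b : ι) :
    inner ℝ (dualFrame n a) (n b) = if a = b then (1 : ℝ) else 0 := by
  rw [inner_dualFrame, ← Matrix.one_apply,
    ← Matrix.nonsing_inv_mul (Matrix.gram ℝ n) (det_gram_ne_zero hn).isUnit, Matrix.mul_apply]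
  rfl

theorem inner_dualFrame_eq_zero {n : ι → W} {w : W} (hw : ∀ b, inner ℝ (n b) w = (0 : ℝ))
    (a : ι) : inner ℝ (dualFrame n a) w = (0 : ℝ) := by
  simp [inner_dualFrame, hw]

/-- Independence is the nonvanishing of the Gram determinant, an open condition. -/
theorem eventually_linearIndependent {X : Type*} [TopologicalSpace X] {n : X → ι → W} {x : X}
    (hn : ∀ a, ContinuousAt (fun y => n y a) x)
    (hx : LinearIndependent ℝ (n x)) : ∀ᶠ y in 𝓝 x, LinearIndependent ℝ (n y) := by
  have hc : ContinuousAt (fun y => (Matrix.gram ℝ (n y)).det) x := by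
    have : ContinuousAt (fun y => Matrix.gram ℝ (n y)) x :=
      continuousAt_pi.2 fun a => continuousAt_pi.2 fun b => (hn a).inner (hn b)
    exact (Continuous.matrix_det continuous_id).continuousAt.comp this
  filter_upwards [hc.eventually_ne (det_gram_ne_zero hx)] with y hy
  exact Matrix.linearIndependent_of_det_gram_ne_zero hy

variable {E : Type*} [NormedAddCommGroup E] [NormedSpace ℝ E] {n : E → ι → W} {x : E} {k : WithTop ℕ∞}

theorem contDiffAt_gram_inv (hn : ∀ a, ContDiffAt ℝ k (fun y => n y a) x)
    (hx : LinearIndependent ℝ (n x)) (a b : ι) :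
    ContDiffAt ℝ k (fun y => (Matrix.gram ℝ (n y))⁻¹ a b) x :=
  contDiffAt_matrix_inv (fun i j => (hn i).inner ℝ (hn j)) (det_gram_ne_zero hx) a b

theorem contDiffAt_dualFrame (hn : ∀ a, ContDiffAt ℝ k (fun y => n y a) x)
    (hx : LinearIndependent ℝ (n x)) (a : ι) :
    ContDiffAt ℝ k (fun y => dualFrame (n y) a) x :=
  ContDiffAt.sum fun b _ => (contDiffAt_gram_inv hn hx a b).smul (hn b)

theorem inner_fderiv_dualFrame_self (hn : ∀ a, ContDiffAt ℝ 1 (fun y => n y a) x)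
    (hx : LinearIndependent ℝ (n x)) (a b : ι) (X : E) :
    inner ℝ (fderiv ℝ (fun y => dualFrame (n y) a) x X) (n x b) +
      inner ℝ (dualFrame (n x) a) (fderiv ℝ (fun y => n y b) x X) = (0 : ℝ) := by
  have h : (fun y => inner ℝ (dualFrame (n y) a) (n y b)) =ᶠ[𝓝 x]
      fun _ => if a = b then (1 : ℝ) else 0 := by
    filter_upwards [eventually_linearIndependent (fun a => (hn a).continuousAt) hx] with y hy
    exact inner_dualFrame_self hy a b
  have h' := congrArg (fun L : E →L[ℝ] ℝ => L X) h.fderiv_eq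
  simp only [fderiv_fun_const] at h'
  rw [fderiv_inner_apply ℝ ((contDiffAt_dualFrame hn hx a).differentiableAt one_ne_zero)
    ((hn b).differentiableAt one_ne_zero)] at h'
  rw [add_comm]
  exact h'

/-- The derivative of the inverse Gram matrix multiplies `n_b`, so it disappears when paired with a
vector orthogonal to all `n_b`. The derivative of `⟨d^a, e_i⟩` can therefore be controlled from a
single tangent vector, without assuming that `e_i` stays orthogonal to the `n_b` nearby. -/
theorem inner_fderiv_dualFrame_eq (hn : ∀ a, ContDiffAt ℝ 1 (fun y => n y a) x)
    (hx : LinearIndependent ℝ (n x)) (a : ι) (X : E) {w : W}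
    (hw : ∀ b, inner ℝ (n x b) w = (0 : ℝ)) :
    inner ℝ (fderiv ℝ (fun y => dualFrame (n y) a) x X) w =
      ∑ b, (Matrix.gram ℝ (n x))⁻¹ a b * inner ℝ (fderiv ℝ (fun y => n y b) x X) w := by
  have hd : fderiv ℝ (fun y => dualFrame (n y) a) x X = ∑ b,
      ((Matrix.gram ℝ (n x))⁻¹ a b • fderiv ℝ (fun y => n y b) x X +
        (fderiv ℝ (fun y => (Matrix.gram ℝ (n y))⁻¹ a b) x X) • n x b) := by
    have := HasFDerivAt.fun_sum (u := Finset.univ) fun b _ =>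
      (((contDiffAt_gram_inv hn hx a b).differentiableAt one_ne_zero).hasFDerivAt).smul
        (((hn b).differentiableAt one_ne_zero).hasFDerivAt)
    have h2 : fderiv ℝ (fun y => dualFrame (n y) a) x = _ := this.fderiv
    rw [h2]
    simp
  rw [hd, sum_inner]
  exact Finset.sum_congr rfl fun b _ => by simp [inner_add_left, real_inner_smul_left, hw]

end DualFrame

/-- The first-order data of a moving frame `(e, n)` at a point of a parameter space. -/
def frameJet {W E : Type*} [NormedAddCommGroup W] [InnerProductSpace ℝ W] [NormedAddCommGroup E]
    [NormedSpace ℝ E] {e : E → Fin 4 → W} {n : E → Fin 5 → W} {x : E}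
    (hn : ∀ a, ContDiffAt ℝ 1 (fun y => n y a) x) (hli : LinearIndependent ℝ (n x))
    (ho : Orthonormal ℝ (e x)) (hen : ∀ i a, inner ℝ (e x i) (n x a) = (0 : ℝ))
    (De : Fin 4 → E →L[ℝ] W) (Dn : Fin 5 → E →L[ℝ] W)
    (hDn : ∀ a, fderiv ℝ (fun y => n y a) x = Dn a) (X : Fin 4 → E)
    (hee : ∀ i j l, inner ℝ (De i (X l)) (e x j) + inner ℝ (e x i) (De j (X l)) = (0 : ℝ))
    (hen' : ∀ i b l, inner ℝ (De i (X l)) (n x b) + inner ℝ (e x i) (Dn b (X l)) = (0 : ℝ))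
    (hDe : ∀ i l, De i (X l) = ∑ j, (inner ℝ (e x j) (De i (X l)) : ℝ) • e x j +
      ∑ a, basisQB a i l • n x a) :
    FrameJet W where
  e := e x
  n := n x
  d := dualFrame (n x)
  De i l := De i (X l)
  Dn b l := Dn b (X l)
  Dd a l := fderiv ℝ (fun y => dualFrame (n y) a) x (X l)
  orthonormal := ho
  inner_e_n := hen
  inner_d_e a i := inner_dualFrame_eq_zero (fun b => by rw [real_inner_comm, hen]) a
  inner_d_n := inner_dualFrame_self hli
  deriv_e_e := hee
  deriv_e_n := hen'
  deriv_d_e a i l := by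
    rw [inner_fderiv_dualFrame_eq hn hli a (X l) (fun b => by rw [real_inner_comm, hen]),
      inner_dualFrame, ← Finset.sum_add_distrib]
    refine Finset.sum_eq_zero fun b _ => ?_
    rw [← mul_add, hDn, real_inner_comm, real_inner_comm (De i (X l)), add_comm, hen', mul_zero]
  deriv_d_n a b l := by
    rw [← hDn]
    exact inner_fderiv_dualFrame_self hn hli a b (X l)
  De_eq := hDe

/-! ### Differential forms on the space of frames -/

section Forms

open scoped Topology

theorem extDerivOneForm_apply {α : OneForm} {u : FrameSpace} (hα : DifferentiableAt ℝ α u)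
    (X Y : FrameSpace) :
    extDerivOneForm α u X Y = fderiv ℝ α u X Y - fderiv ℝ α u Y X := by
  let Φ := (ContinuousAlternatingMap.ofSubsingletonLIE (𝕜 := ℝ) (E := FrameSpace) (F := ℝ)
    (0 : Fin 1)).toContinuousLinearEquiv
  have h : HasFDerivAt
      (fun v => ContinuousAlternatingMap.ofSubsingleton ℝ FrameSpace ℝ (0 : Fin 1) (α v))
      (Φ.toContinuousLinearMap.comp (fderiv ℝ α u)) u :=
    Φ.hasFDerivAt.comp u hα.hasFDerivAt
  rw [extDerivOneForm, extDeriv, h.fderiv, ContinuousAlternatingMap.alternatizeUncurryFin_apply,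
    Fin.sum_univ_two]
  simp [Fin.removeNth, sub_eq_add_neg, Φ]

theorem extDerivOneForm_sub {α β : OneForm} {u : FrameSpace} (hα : DifferentiableAt ℝ α u)
    (hβ : DifferentiableAt ℝ β u) (X Y : FrameSpace) :
    extDerivOneForm (fun v => α v - β v) u X Y =
      extDerivOneForm α u X Y - extDerivOneForm β u X Y := by
  rw [extDerivOneForm_apply (hα.fun_sub hβ), extDerivOneForm_apply hα, extDerivOneForm_apply hβ,
    fderiv_fun_sub hα hβ]
  simp only [sub_apply]
  ring

theorem extDerivOneForm_smul (c : ℝ) {α : OneForm} {u : FrameSpace}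
    (hα : DifferentiableAt ℝ α u) (X Y : FrameSpace) :
    extDerivOneForm (fun v => c • α v) u X Y = c * extDerivOneForm α u X Y := by
  rw [extDerivOneForm_apply (hα.fun_const_smul c), extDerivOneForm_apply hα, fderiv_fun_const_smul hα]
  simp only [smul_apply, smul_eq_mul]
  ring

theorem extDerivOneForm_sum {ι : Type*} (s : Finset ι) {α : ι → OneForm} {u : FrameSpace}
    (hα : ∀ i ∈ s, DifferentiableAt ℝ (α i) u) (X Y : FrameSpace) :
    extDerivOneForm (fun v => ∑ i ∈ s, α i v) u X Y = ∑ i ∈ s, extDerivOneForm (α i) u X Y := by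
  rw [extDerivOneForm_apply (DifferentiableAt.fun_sum hα), fderiv_fun_sum hα]
  simp only [sum_apply, ← Finset.sum_sub_distrib]
  exact Finset.sum_congr rfl fun i hi => (extDerivOneForm_apply (hα i hi) X Y).symm

/-- The component along `w` of a differential `L`. -/
def componentForm (w : FrameSpace → V9) (L : FrameSpace →L[ℝ] V9) : OneForm :=
  fun u => (innerSL ℝ (w u)).comp L

theorem componentForm_apply (w : FrameSpace → V9) (L : FrameSpace →L[ℝ] V9) (u X : FrameSpace) :
    componentForm w L u X = inner ℝ (w u) (L X) := rfl

theorem contDiffAt_componentForm {w : FrameSpace → V9} {u : FrameSpace} {k : WithTop ℕ∞}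
    (hw : ContDiffAt ℝ k w u) (L : FrameSpace →L[ℝ] V9) : ContDiffAt ℝ k (componentForm w L) u :=
  ((innerSL ℝ (E := V9)).contDiff.contDiffAt.comp u hw).clm_comp contDiffAt_const

/-- `L` is constant, being the differential of a linear coordinate, so only `w` is differentiated:
`d⟨w, L⟩ = ⟨dw ∧ L⟩`. -/
theorem extDerivOneForm_componentForm {w : FrameSpace → V9} {u : FrameSpace}
    (hw : ContDiffAt ℝ 1 w u) (L : FrameSpace →L[ℝ] V9) (X Y : FrameSpace) :
    extDerivOneForm (componentForm w L) u X Y =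
      inner ℝ (fderiv ℝ w u X) (L Y) - inner ℝ (fderiv ℝ w u Y) (L X) := by
  have hd := (contDiffAt_componentForm hw L).differentiableAt one_ne_zero
  have hw' := hw.differentiableAt one_ne_zero
  have key : ∀ X Y, fderiv ℝ (componentForm w L) u X Y = inner ℝ (fderiv ℝ w u X) (L Y) := by
    intro X Y
    have h1 : fderiv ℝ (fun v => componentForm w L v Y) u X =
        fderiv ℝ (componentForm w L) u X Y := by
      rw [fderiv_clm_apply hd (differentiableAt_const Y)]
      simp
    rw [← h1]
    simp only [componentForm_apply]
    rw [fderiv_inner_apply ℝ hw' (differentiableAt_const _)]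
    simp
  rw [extDerivOneForm_apply hd, key, key]

end Forms

/-! ### Integral elements -/

section IntegralElements

open scoped Topology

/-- The differential `dν_a` of the frame vector `ν_a`. -/
def dNormal (a : Fin 5) : FrameSpace →L[ℝ] V9 :=
  (ContinuousLinearMap.proj (R := ℝ) (φ := fun _ : Fin 5 => V9) a).comp
    ((ContinuousLinearMap.snd ℝ (Fin 4 → V9) (Fin 5 → V9)).comp
      (ContinuousLinearMap.snd ℝ V9 ((Fin 4 → V9) × (Fin 5 → V9))))

/-- The connection form `φ^j_i`, the `e_j`-component of `de_i`. -/
def phiForm (j i : Fin 4) : OneForm := componentForm (fun u => u.2.1 j) (dTangent i)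

/-- The connection form `κ^a_b`, the `ν_a`-component of `dν_b`. -/
def kappaForm (a b : Fin 5) : OneForm := componentForm (fun u => dualFrame u.2.2 a) (dNormal b)

theorem omegaForm_eq (i : Fin 4) : omegaForm i = componentForm (fun u => u.2.1 i) dBase := rfl

theorem sum_comp_innerSL (n : Fin 5 → V9) (a : Fin 5) (L : FrameSpace →L[ℝ] V9) :
    ∑ b, (Matrix.gram ℝ n)⁻¹ a b • (innerSL ℝ (n b)).comp L =
      (innerSL ℝ (dualFrame n a)).comp L := by
  refine ContinuousLinearMap.ext fun X => ?_
  simp [dualFrame]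

/-- The inverse metric raises the normal index: the `ν_a`-component is the pairing with the dual
vector. -/
theorem thetaForm_eq (a : Fin 5) :
    thetaForm a = componentForm (fun u => dualFrame u.2.2 a) dBase :=
  funext fun u => sum_comp_innerSL u.2.2 a dBase

theorem etaForm_eq (a : Fin 5) (i : Fin 4) :
    etaForm a i = componentForm (fun u => dualFrame u.2.2 a) (dTangent i) :=
  funext fun u => sum_comp_innerSL u.2.2 a (dTangent i)

variable {u : FrameSpace} {k : WithTop ℕ∞}

theorem contDiffAt_normal (a : Fin 5) : ContDiffAt ℝ k (fun v : FrameSpace => v.2.2 a) u :=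
  (dNormal a).contDiff.contDiffAt

theorem contDiffAt_tangent (i : Fin 4) : ContDiffAt ℝ k (fun v : FrameSpace => v.2.1 i) u :=
  (dTangent i).contDiff.contDiffAt

theorem fderiv_normal (a : Fin 5) : fderiv ℝ (fun v : FrameSpace => v.2.2 a) u = dNormal a :=
  (dNormal a).fderiv

theorem fderiv_tangent (i : Fin 4) : fderiv ℝ (fun v : FrameSpace => v.2.1 i) u = dTangent i :=
  (dTangent i).fderiv

theorem contDiffAt_dual (hu : u ∈ semiOrthonormalFrames) (a : Fin 5) :
    ContDiffAt ℝ k (fun v : FrameSpace => dualFrame v.2.2 a) u :=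
  contDiffAt_dualFrame contDiffAt_normal hu.2.2 a

theorem contDiffAt_omegaForm (i : Fin 4) : ContDiffAt ℝ k (omegaForm i) u :=
  contDiffAt_componentForm (contDiffAt_tangent i) _

theorem contDiffAt_phiForm (j i : Fin 4) : ContDiffAt ℝ k (phiForm j i) u :=
  contDiffAt_componentForm (contDiffAt_tangent j) _

theorem contDiffAt_kappaForm (hu : u ∈ semiOrthonormalFrames) (a b : Fin 5) :
    ContDiffAt ℝ k (kappaForm a b) u :=
  contDiffAt_componentForm (contDiffAt_dual hu a) _

theorem contDiffAt_thetaForm (hu : u ∈ semiOrthonormalFrames) (a : Fin 5) :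
    ContDiffAt ℝ k (thetaForm a) u := by
  rw [thetaForm_eq]
  exact contDiffAt_componentForm (contDiffAt_dual hu a) _

theorem contDiffAt_etaForm (hu : u ∈ semiOrthonormalFrames) (a : Fin 5) (i : Fin 4) :
    ContDiffAt ℝ k (etaForm a i) u := by
  rw [etaForm_eq]
  exact contDiffAt_componentForm (contDiffAt_dual hu a) _

/-- The standard system is contained in the prolonged system. -/
theorem standardSystem_subset_prolongedSystem : standardSystem ⊆ prolongedSystem := by
  intro α hα
  refine ⟨fun u hu => ?_, fun u _ E hE => (hE.2.2.2 α hα).1⟩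
  rcases hα with ⟨a, rfl⟩ | ⟨a, i, rfl⟩
  · exact contDiffAt_thetaForm hu a
  · exact (contDiffAt_etaForm hu a i).sub
      (ContDiffAt.sum fun j _ => contDiffAt_const.fun_smul (contDiffAt_omegaForm j))

/-- The expansion of a vector in a semi-orthonormal frame. -/
theorem eq_sum_frame (hu : u ∈ semiOrthonormalFrames) (w : V9) :
    w = ∑ i, (inner ℝ (u.2.1 i) w : ℝ) • u.2.1 i +
      ∑ a, (inner ℝ (dualFrame u.2.2 a) w : ℝ) • u.2.2 a := by
  obtain ⟨ho, hen, hli⟩ := hu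
  have hde : ∀ a i, (inner ℝ (dualFrame u.2.2 a) (u.2.1 i) : ℝ) = 0 := fun a i =>
    inner_dualFrame_eq_zero (fun b => by rw [real_inner_comm, hen]) a
  have hei : ∀ i j, (inner ℝ (u.2.1 i) (u.2.1 j) : ℝ) = if i = j then 1 else 0 :=
    orthonormal_iff_ite.1 ho
  let Φ : V9 →ₗ[ℝ] (Fin 4 → ℝ) × (Fin 5 → ℝ) :=
    (LinearMap.pi fun i => (innerSL ℝ (u.2.1 i)).toLinearMap).prod
      (LinearMap.pi fun a => (innerSL ℝ (dualFrame u.2.2 a)).toLinearMap)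
  have hΦ : ∀ (c : Fin 4 → ℝ) (b : Fin 5 → ℝ),
      Φ (∑ i, c i • u.2.1 i + ∑ a, b a • u.2.2 a) = (c, b) := by
    intro c b
    refine Prod.ext (funext fun i => ?_) (funext fun a => ?_)
    · simp [Φ, hei, hen]
    · simp [Φ, hde, inner_dualFrame_self hli]
  -- The coordinate map is onto by `hΦ`, and `4 + 5 = 9` makes it injective.
  have hinj : Function.Injective Φ :=
    (LinearMap.injective_iff_surjective_of_finrank_eq_finrank (by simp)).2
      fun x => ⟨_, hΦ x.1 x.2⟩
  exact hinj ((hΦ _ _).trans rfl).symm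

variable {E : Submodule ℝ FrameSpace}

/-- An admissible integral element has a basis dual to the forms `ω^i`. -/
theorem IsAdmissibleIntegralElement.exists_basis {𝓘 : Set OneForm}
    (hE : IsAdmissibleIntegralElement 𝓘 u E) :
    ∃ X : Fin 4 → FrameSpace, (∀ l, X l ∈ E) ∧
      (∀ i l, omegaForm i u (X l) = if i = l then 1 else 0) ∧
      ∀ Y ∈ E, Y = ∑ l, omegaForm l u Y • X l := by
  let Φ : E →ₗ[ℝ] (Fin 4 → ℝ) :=
    (LinearMap.pi fun i => (omegaForm i u).toLinearMap).comp E.subtype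
  have hΦ : ∀ (Y : E) i, Φ Y i = omegaForm i u Y := fun _ _ => rfl
  have hinj : Function.Injective Φ := by
    refine (injective_iff_map_eq_zero Φ).2 fun Y hY => Subtype.ext ?_
    exact hE.2.2.1 Y Y.2 fun i => by rw [← hΦ, hY]; rfl
  have hsurj : Function.Surjective Φ :=
    (LinearMap.injective_iff_surjective_of_finrank_eq_finrank (by simp [hE.1])).1 hinj
  choose X hX using fun l : Fin 4 => hsurj (Pi.single l 1)
  have hω : ∀ i l, omegaForm i u (X l) = if i = l then 1 else 0 := fun i l => by
    rw [← hΦ, hX, Pi.single_apply]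
  refine ⟨fun l => X l, fun l => (X l).2, hω, fun Y hY => ?_⟩
  have : (⟨Y, hY⟩ : E) = ∑ l, omegaForm l u Y • X l := by
    refine hinj (funext fun i => ?_)
    rw [map_sum, Finset.sum_apply]
    simp only [map_smul, hX, Pi.smul_apply, Pi.single_apply, smul_eq_mul, mul_ite, mul_one,
      mul_zero]
    simp [hΦ]
  simpa using congrArg (Subtype.val) this

/-! ### The frame jet carried by an integral element -/

section Jet

variable {X : Fin 4 → FrameSpace}

theorem dBase_eq (hu : u ∈ semiOrthonormalFrames)
    (hE : IsAdmissibleIntegralElement standardSystem u E) (hX : ∀ l, X l ∈ E)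
    (hω : ∀ i l, omegaForm i u (X l) = if i = l then 1 else 0) (l : Fin 4) :
    dBase (X l) = u.2.1 l := by
  have h1 : ∀ i, (inner ℝ (u.2.1 i) (dBase (X l)) : ℝ) = if i = l then 1 else 0 := fun i => hω i l
  have h2 : ∀ a, (inner ℝ (dualFrame u.2.2 a) (dBase (X l)) : ℝ) = 0 := fun a => by
    rw [← componentForm_apply (fun u => dualFrame u.2.2 a), ← thetaForm_eq]
    exact (hE.2.2.2 _ (Or.inl ⟨a, rfl⟩)).1 _ (hX l)
  rw [eq_sum_frame hu (dBase (X l))]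
  simp [h1, h2]

theorem dTangent_eq (hu : u ∈ semiOrthonormalFrames)
    (hE : IsAdmissibleIntegralElement standardSystem u E) (hX : ∀ l, X l ∈ E)
    (hω : ∀ i l, omegaForm i u (X l) = if i = l then 1 else 0) (i l : Fin 4) :
    dTangent i (X l) = ∑ j, (inner ℝ (u.2.1 j) (dTangent i (X l)) : ℝ) • u.2.1 j +
      ∑ a, basisQB a i l • u.2.2 a := by
  have h2 : ∀ a, (inner ℝ (dualFrame u.2.2 a) (dTangent i (X l)) : ℝ) = basisQB a i l :=
    fun a => by
      rw [← componentForm_apply (fun u => dualFrame u.2.2 a), ← etaForm_eq]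
      have := (hE.2.2.2 _ (Or.inr ⟨a, i, rfl⟩)).1 _ (hX l)
      simp only [sub_apply, sum_apply, smul_apply, hω, smul_eq_mul] at this
      simpa [sub_eq_zero] using this
  conv_lhs => rw [eq_sum_frame hu (dTangent i (X l))]
  simp only [h2]

/-- The first-order data of an admissible integral element. -/
def integralJet (hu : u ∈ semiOrthonormalFrames)
    (hE : IsAdmissibleIntegralElement standardSystem u E) (hX : ∀ l, X l ∈ E)
    (hω : ∀ i l, omegaForm i u (X l) = if i = l then 1 else 0) : FrameJet V9 :=
  frameJet (e := fun u : FrameSpace => u.2.1) (n := fun u : FrameSpace => u.2.2)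
    contDiffAt_normal hu.2.2 hu.1 hu.2.1 dTangent dNormal fderiv_normal X
    (fun i j l => (hE.2.1 _ (hX l)).1 i j) (fun i b l => (hE.2.1 _ (hX l)).2 i b)
    (dTangent_eq hu hE hX hω)

variable (hu : u ∈ semiOrthonormalFrames)
  (hE : IsAdmissibleIntegralElement standardSystem u E) (hX : ∀ l, X l ∈ E)
  (hω : ∀ i l, omegaForm i u (X l) = if i = l then 1 else 0)

/-- Closedness is automatic here because the nine frame vectors span `ℝ⁹`. -/
theorem integralJet_isClosed : (integralJet hu hE hX hω).IsClosed := fun b l => by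
  rw [add_comm]
  exact eq_sum_frame hu (dNormal b (X l))

theorem integralJet_isIntegral : (integralJet hu hE hX hω).IsIntegral := by
  intro a i l k
  have hη := (contDiffAt_etaForm (k := 1) hu a i).differentiableAt one_ne_zero
  have hS : ∀ j, DifferentiableAt ℝ (fun v => basisQB a i j • omegaForm j v) u := fun j =>
    ((contDiffAt_omegaForm (k := 1) j).differentiableAt one_ne_zero).fun_const_smul _
  have := (hE.2.2.2 _ (Or.inr ⟨a, i, rfl⟩)).2 _ (hX l) _ (hX k)
  rw [extDerivOneForm_sub hη (DifferentiableAt.fun_sum fun j _ => hS j),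
    extDerivOneForm_sum _ fun j _ => hS j, sub_eq_zero, etaForm_eq,
    extDerivOneForm_componentForm (contDiffAt_dual hu a)] at this
  refine this.trans (Finset.sum_congr rfl fun j _ => ?_)
  rw [extDerivOneForm_smul _ ((contDiffAt_omegaForm (k := 1) j).differentiableAt one_ne_zero),
    omegaForm_eq, extDerivOneForm_componentForm (contDiffAt_tangent j), fderiv_tangent,
    dBase_eq hu hE hX hω, dBase_eq hu hE hX hω]
  rfl

end Jet

/-- A combination of connection forms which vanishes on the basis of every admissible integral
element dual to the `ω^i` belongs to the prolonged system. -/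
theorem mem_prolongedSystem {α : OneForm}
    (hα : ∀ u ∈ semiOrthonormalFrames, ContDiffAt ℝ ∞ α u)
    (h : ∀ u ∈ semiOrthonormalFrames, ∀ E : Submodule ℝ FrameSpace,
      IsAdmissibleIntegralElement standardSystem u E → ∀ X : Fin 4 → FrameSpace, (∀ l, X l ∈ E) →
      (∀ i l, omegaForm i u (X l) = if i = l then 1 else 0) → ∀ l,
      α u (X l) = 0) : α ∈ prolongedSystem := by
  refine ⟨hα, fun u hu E hE Y hY => ?_⟩
  obtain ⟨X, hX, hω, hspan⟩ := hE.exists_basis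
  rw [hspan Y hY, map_sum]
  exact Finset.sum_eq_zero fun l _ => by rw [map_smul, h u hu E hE X hX hω, smul_zero]

/-- The forms `κ^a_b - c φ^j_i` that vanish on all admissible integral elements. -/
theorem kappaForm_sub_phiForm_mem {a b : Fin 5} {j i : Fin 4} {c : ℝ}
    (h : ∀ (J : FrameJet V9) (_ : J.IsIntegral) (l : Fin 4), J.kappa a b l = c * J.phi j i l) :
    (fun u => kappaForm a b u - c • phiForm j i u) ∈ prolongedSystem := by
  refine mem_prolongedSystem (fun u hu => (contDiffAt_kappaForm hu a b).sub
    (contDiffAt_const.fun_smul (contDiffAt_phiForm j i))) fun u hu E hE X hX hω l => ?_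
  exact sub_eq_zero.2 (h _ (integralJet_isIntegral hu hE hX hω) l)

/-- Third relation of `connection_relations`, as a 1-form of the prolonged system. -/
theorem kappaForm_sub_kappaForm_mem :
    (fun u => (kappaForm 1 0 u - kappaForm 2 3 u) - (-2 : ℝ) • phiForm 2 3 u) ∈
      prolongedSystem := by
  refine mem_prolongedSystem (fun u hu => ((contDiffAt_kappaForm hu 1 0).sub
    (contDiffAt_kappaForm hu 2 3)).sub (contDiffAt_const.fun_smul (contDiffAt_phiForm 2 3)))
    fun u hu E hE X hX hω l => ?_
  let J := integralJet hu hE hX hω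
  exact sub_eq_zero.2 (connection_relations J.phi_skew
    (J.structureDefect_symm (integralJet_isIntegral hu hE hX hω)) l).2.2

/-- The prolonged system has no admissible integral elements. -/
theorem not_isAdmissibleIntegralElement_prolongedSystem (hu : u ∈ semiOrthonormalFrames)
    (E : Submodule ℝ FrameSpace) : ¬ IsAdmissibleIntegralElement prolongedSystem u E := by
  intro hP
  -- The enlarged system imposes more conditions, so `E` still carries an integral jet satisfying
  -- the linear relations.
  have hE : IsAdmissibleIntegralElement standardSystem u E :=
    ⟨hP.1, hP.2.1, hP.2.2.1, fun α hα =>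
      hP.2.2.2 α (standardSystem_subset_prolongedSystem hα)⟩
  obtain ⟨X, hX, hω, -⟩ := hE.exists_basis
  let J := integralJet hu hE hX hω
  have dκ : ∀ a b l k, extDerivOneForm (kappaForm a b) u (X l) (X k) =
      inner ℝ (J.Dd a l) (J.Dn b k) - inner ℝ (J.Dd a k) (J.Dn b l) := fun a b l k =>
    extDerivOneForm_componentForm (contDiffAt_dual hu a) _ _ _
  have dφ : ∀ j i l k, extDerivOneForm (phiForm j i) u (X l) (X k) =
      inner ℝ (J.De j l) (J.De i k) - inner ℝ (J.De j k) (J.De i l) := fun j i l k => by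
    rw [phiForm, extDerivOneForm_componentForm (contDiffAt_tangent j), fderiv_tangent]
    rfl
  have hκ : ∀ a b, DifferentiableAt ℝ (kappaForm a b) u := fun a b =>
    (contDiffAt_kappaForm (k := 1) hu a b).differentiableAt one_ne_zero
  have hφ : ∀ j i, DifferentiableAt ℝ (phiForm j i) u := fun j i =>
    (contDiffAt_phiForm (k := 1) j i).differentiableAt one_ne_zero
  -- The form `κ^a_b - 2φ^j_i` lies in the prolonged system, so its exterior derivative must vanish
  -- on `E` as well.
  have rel : ∀ (a b : Fin 5) (j i : Fin 4),
      (∀ (J : FrameJet V9) (_ : J.IsIntegral) (l : Fin 4), J.kappa a b l = 2 * J.phi j i l) →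
      ∀ l k, (inner ℝ (J.Dd a l) (J.Dn b k) - inner ℝ (J.Dd a k) (J.Dn b l) : ℝ) =
        2 * (inner ℝ (J.De j l) (J.De i k) - inner ℝ (J.De j k) (J.De i l)) := by
    intro a b j i h l k
    have := (hP.2.2.2 _ (kappaForm_sub_phiForm_mem h)).2 _ (hX l) _ (hX k)
    rw [extDerivOneForm_sub (hκ a b) ((hφ j i).fun_const_smul _),
      extDerivOneForm_smul _ (hφ j i), dκ, dφ, sub_eq_zero] at this
    exact this
  refine J.not_isIntegral (integralJet_isClosed hu hE hX hω) (integralJet_isIntegral hu hE hX hω)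
    (rel 4 0 0 2 (fun J hJ l =>
      (connection_relations J.phi_skew (J.structureDefect_symm hJ) l).1) 0 2)
    (rel 4 3 1 3 (fun J hJ l =>
      (connection_relations J.phi_skew (J.structureDefect_symm hJ) l).2.1) 1 3) ?_
  have := (hP.2.2.2 _ kappaForm_sub_kappaForm_mem).2 _ (hX 2) _ (hX 3)
  rw [extDerivOneForm_sub ((hκ 1 0).fun_sub (hκ 2 3)) ((hφ 2 3).fun_const_smul _),
    extDerivOneForm_sub (hκ 1 0) (hκ 2 3), extDerivOneForm_smul _ (hφ 2 3), dκ, dκ, dφ,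
    sub_eq_zero] at this
  exact this

end IntegralElements

/-! ### Recovering the block decomposition from a space conjugate to `QB` -/

section Splitting

abbrev Mat4 : Type := Matrix (Fin 4) (Fin 4) ℝ

/-- The Gram matrix of the trace form. -/
def traceGram (A : Fin 5 → Mat4) : Matrix (Fin 5) (Fin 5) ℝ :=
  Matrix.of fun a b => (A a * A b).trace

/-- The contraction of `X` with the inverse of the trace form on the span of `A`. -/
def traceContraction (A : Fin 5 → Mat4) (X : Mat4) : Mat4 :=
  ∑ a, ∑ b, (traceGram A)⁻¹ a b • (A a * X * A b)

/-- If the matrices `A` span a space conjugate to `QB` this is a multiple of the corresponding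
conjugate of the matrix with diagonal blocks `I` and `-I`. -/
def splitting (A : Fin 5 → Mat4) (X : Mat4) : Mat4 :=
  (4⁻¹ : ℝ) • X - traceContraction A X + (4⁻¹ * X.trace) • 1

theorem traceGram_basisQB : traceGram basisQB = Matrix.diagonal ![2, 2, 2, 2, 4] := by
  ext a b
  fin_cases a <;> fin_cases b <;>
    simp [traceGram, basisQB, Matrix.trace, Fin.sum_univ_four, Matrix.mul_apply] <;> norm_num

theorem traceGram_sum_smul (M : Matrix (Fin 5) (Fin 5) ℝ) (S : Fin 5 → Mat4) :
    traceGram (fun a => ∑ b, M a b • S b) = M * traceGram S * M.transpose := by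
  ext a b
  simp only [traceGram, Matrix.of_apply]
  rw [Finset.sum_mul_sum, Matrix.trace_sum]
  simp only [Matrix.trace_sum, smul_mul_smul_comm, Matrix.trace_smul, smul_eq_mul,
    Matrix.mul_apply, Matrix.transpose_apply, Finset.sum_mul, Matrix.of_apply]
  rw [Finset.sum_comm]
  exact Finset.sum_congr rfl fun c _ => Finset.sum_congr rfl fun d _ => by ring

/-- Independence of the basis of the span: the Gram matrix becomes `M G Mᵀ`, so its inverse absorbs
both factors of `M`. -/
theorem traceContraction_sum_smul {M : Matrix (Fin 5) (Fin 5) ℝ} (hM : M.det ≠ 0)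
    (S : Fin 5 → Mat4) (X : Mat4) :
    traceContraction (fun a => ∑ b, M a b • S b) X = traceContraction S X := by
  have hu : IsUnit M.det := hM.isUnit
  have hut : IsUnit M.transpose.det := by rwa [Matrix.det_transpose]
  have h : M.transpose * (traceGram fun a => ∑ b, M a b • S b)⁻¹ * M = (traceGram S)⁻¹ := by
    rw [traceGram_sum_smul, Matrix.mul_inv_rev, Matrix.mul_inv_rev, ← Matrix.mul_assoc,
      Matrix.mul_nonsing_inv _ hut, Matrix.one_mul, Matrix.mul_assoc, Matrix.nonsing_inv_mul _ hu,
      Matrix.mul_one]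
  unfold traceContraction
  rw [← h]
  generalize (traceGram fun a => ∑ b, M a b • S b)⁻¹ = K
  simp only [Matrix.mul_apply, Matrix.transpose_apply, Finset.sum_mul, Finset.mul_sum,
    Finset.sum_smul, Finset.smul_sum, Matrix.smul_mul, Matrix.mul_smul, smul_smul]
  have : ∀ f : Fin 5 → Fin 5 → Fin 5 → Fin 5 → Mat4,
      ∑ a, ∑ b, ∑ d, ∑ c, f a b c d = ∑ c, ∑ d, ∑ b, ∑ a, f a b c d := by
    intro f
    calc _ = ∑ a, ∑ c, ∑ d, ∑ b, f a b c d := by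
          refine Finset.sum_congr rfl fun a _ => ?_
          rw [Finset.sum_comm]
          rw [Finset.sum_congr rfl fun d _ => Finset.sum_comm]
          rw [Finset.sum_comm]
      _ = _ := by
          rw [Finset.sum_comm]
          refine Finset.sum_congr rfl fun c _ => ?_
          rw [Finset.sum_comm]
          exact Finset.sum_congr rfl fun d _ => Finset.sum_comm
  rw [this]
  exact Finset.sum_congr rfl fun c _ => Finset.sum_congr rfl fun d _ => Finset.sum_congr rfl
    fun b _ => Finset.sum_congr rfl fun a _ => by congr 1; ring

/-- For `X` with diagonal blocks `P`, `R` and off-diagonal block `Q`, the contraction has diagonal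
blocks `P/4 + (tr R / 2) I` and `R/4 + (tr P / 2) I`, and off-diagonal block `Q/4`. Subtracting it
from `X/4` and adding `(tr X / 4) I` leaves `((tr P - tr R)/4) diag(I, -I)`. -/
theorem splitting_basisQB {X : Mat4} (hX : X.IsSymm) :
    splitting basisQB X = (4⁻¹ * (basisQB 4 * X).trace) • basisQB 4 := by
  have hinv : (traceGram basisQB)⁻¹ = Matrix.diagonal ![2⁻¹, 2⁻¹, 2⁻¹, 2⁻¹, 4⁻¹] := by
    rw [traceGram_basisQB]
    refine Matrix.inv_eq_right_inv ?_
    ext a b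
    fin_cases a <;> fin_cases b <;> simp
  have h10 := hX.apply 0 1
  have h20 := hX.apply 0 2
  have h30 := hX.apply 0 3
  have h21 := hX.apply 1 2
  have h31 := hX.apply 1 3
  have h32 := hX.apply 2 3
  have hL : traceContraction basisQB X = ∑ a, (![2⁻¹, 2⁻¹, 2⁻¹, 2⁻¹, 4⁻¹] : Fin 5 → ℝ) a •
      (basisQB a * X * basisQB a) := by
    unfold traceContraction
    rw [hinv]
    refine Finset.sum_congr rfl fun a _ => ?_
    rw [Finset.sum_eq_single a (fun b _ hb => by rw [Matrix.diagonal_apply_ne _ hb.symm, zero_smul])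
      (fun h => absurd (Finset.mem_univ a) h), Matrix.diagonal_apply_eq]
  rw [splitting, hL]
  ext i j
  simp only [Fin.sum_univ_five, Matrix.trace, Matrix.diag_apply, Fin.sum_univ_four,
    Matrix.add_apply, Matrix.sub_apply, Matrix.smul_apply, Matrix.mul_apply, smul_eq_mul]
  fin_cases i <;> fin_cases j <;>
    simp [basisQB, h10, h20, h30, h21, h31, h32] <;> ring

theorem splitting_conj {C D : Mat4} (hDC : D * C = 1) (A : Fin 5 → Mat4) (X : Mat4) :
    splitting (fun a => C * A a * D) (C * X * D) = C * splitting A X * D := by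
  have hCD : C * D = 1 := mul_eq_one_comm.1 hDC
  have hm : ∀ Y Z : Mat4, C * Y * D * (C * Z * D) = C * (Y * Z) * D := fun Y Z => by
    calc _ = C * Y * (D * C) * Z * D := by simp only [Matrix.mul_assoc]
      _ = _ := by rw [hDC]; simp only [Matrix.mul_assoc, Matrix.one_mul]
  have htr : ∀ Y : Mat4, (C * Y * D).trace = Y.trace := fun Y => by
    rw [Matrix.trace_mul_comm, ← Matrix.mul_assoc, hDC, Matrix.one_mul]
  have hg : traceGram (fun a => C * A a * D) = traceGram A := by
    ext a b
    simp only [traceGram, Matrix.of_apply, hm, htr]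
  have hL : traceContraction (fun a => C * A a * D) (C * X * D) =
      C * traceContraction A X * D := by
    simp only [traceContraction, hg, hm, Matrix.mul_sum, Matrix.sum_mul, Matrix.mul_smul,
      Matrix.smul_mul]
  rw [splitting, splitting, hL, htr]
  simp only [Matrix.mul_add, Matrix.mul_sub, Matrix.add_mul, Matrix.sub_mul, Matrix.mul_smul,
    Matrix.smul_mul, Matrix.mul_one, hCD]

/-- Basis independence and conjugation equivariance transport the model computation to any spanning
family of a conjugate of `QB`. The formula refers only to `A`, so the unknown `C` may depend on the
point in an arbitrary way. -/
theorem splitting_of_conj {C D : Mat4} (hDC : D * C = 1) {M : Matrix (Fin 5) (Fin 5) ℝ}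
    {A : Fin 5 → Mat4} (hA : ∀ a, A a = C * (∑ b, M a b • basisQB b) * D)
    (hG : (traceGram A).det ≠ 0) {X : Mat4} (hX : X.IsSymm) :
    splitting A (C * X * D) = (4⁻¹ * (basisQB 4 * X).trace) • (C * basisQB 4 * D) := by
  -- The Gram matrix of `A` is `M G Mᵀ`, so its nondegeneracy, which is an open condition, forces
  -- `M` to be invertible.
  have hM : M.det ≠ 0 := by
    intro h
    refine hG ?_
    have : traceGram A = M * traceGram basisQB * M.transpose := by
      rw [← traceGram_sum_smul]
      ext a b
      simp only [traceGram, Matrix.of_apply, hA]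
      rw [show C * (∑ b, M a b • basisQB b) * D * (C * (∑ c, M b c • basisQB c) * D) =
        C * (∑ b, M a b • basisQB b) * (D * C) * (∑ c, M b c • basisQB c) * D by
          simp only [Matrix.mul_assoc], hDC, Matrix.mul_one, Matrix.trace_mul_comm]
      simp only [← Matrix.mul_assoc, hDC, Matrix.one_mul]
    rw [this, Matrix.det_mul, Matrix.det_mul, h, zero_mul, zero_mul]
  rw [funext hA, splitting_conj hDC, ← Matrix.smul_mul, ← Matrix.mul_smul, ← splitting_basisQB hX]
  simp only [splitting, traceContraction_sum_smul hM]

end Splitting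

/-! ### Adapted frames of an immersion of an open set -/

section LocalGeometry

open scoped Topology

variable {W : Type*} [NormedAddCommGroup W] [InnerProductSpace ℝ W]

/-- The rejection of `w` from the span of `n` is orthogonal to `n`. -/
theorem inner_sub_sum_dualFrame {ι : Type*} [Fintype ι] [DecidableEq ι] {n : ι → W}
    (hn : LinearIndependent ℝ n) (w : W) (i : ι) :
    inner ℝ (w - ∑ j, (inner ℝ (dualFrame n j) w : ℝ) • n j) (n i) = (0 : ℝ) := by
  have key : ∀ k, ∑ j, (Matrix.gram ℝ n)⁻¹ j k * inner ℝ (n j) (n i) =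
      if i = k then (1 : ℝ) else 0 := fun k => by
    rw [← Matrix.one_apply, ← Matrix.mul_nonsing_inv (Matrix.gram ℝ n) (det_gram_ne_zero hn).isUnit,
      Matrix.mul_apply]
    exact Finset.sum_congr rfl fun j _ => by rw [Matrix.gram_apply, real_inner_comm, mul_comm]
  rw [inner_sub_left, sum_inner]
  simp only [real_inner_smul_left, inner_dualFrame, Finset.sum_mul]
  rw [Finset.sum_comm]
  have : ∀ k, ∑ j, (Matrix.gram ℝ n)⁻¹ j k * inner ℝ (n k) w * inner ℝ (n j) (n i) =
      inner ℝ (n k) w * if i = k then (1 : ℝ) else 0 := fun k => by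
    rw [← key, Finset.mul_sum]
    exact Finset.sum_congr rfl fun j _ => by ring
  simp only [this]
  simp [real_inner_comm]

/-- Smooth orthonormalization of a pair of vector fields. -/
theorem exists_orthonormal_pair {E : Type*} [NormedAddCommGroup E] [NormedSpace ℝ E]
    {T : E → E →L[ℝ] W} {q₀ q₁ : E → E} {x : E}
    (hT : ContDiffAt ℝ ∞ T x) (h₀ : ContDiffAt ℝ ∞ q₀ x) (h₁ : ContDiffAt ℝ ∞ q₁ x)
    (hn₀ : ‖T x (q₀ x)‖ = 1) (hn₁ : ‖T x (q₁ x)‖ = 1)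
    (hi : inner ℝ (T x (q₀ x)) (T x (q₁ x)) = (0 : ℝ)) :
    ∃ e₀ e₁ : E → E, ContDiffAt ℝ ∞ e₀ x ∧ ContDiffAt ℝ ∞ e₁ x ∧
      e₀ x = q₀ x ∧ e₁ x = q₁ x ∧
      (∀ y, e₀ y ∈ Submodule.span ℝ {q₀ y, q₁ y} ∧ e₁ y ∈ Submodule.span ℝ {q₀ y, q₁ y}) ∧
      ∀ᶠ y in 𝓝 x, ‖T y (e₀ y)‖ = 1 ∧ ‖T y (e₁ y)‖ = 1 ∧
        inner ℝ (T y (e₀ y)) (T y (e₁ y)) = (0 : ℝ) := by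
  have normalize : ∀ q : E → E, ContDiffAt ℝ ∞ q x → ‖T x (q x)‖ = 1 →
      ContDiffAt ℝ ∞ (fun y => ‖T y (q y)‖⁻¹ • q y) x ∧ ‖T x (q x)‖⁻¹ • q x = q x ∧
      ∀ᶠ y in 𝓝 x, ‖T y (‖T y (q y)‖⁻¹ • q y)‖ = 1 := by
    intro q hq hn
    have hTq : ContDiffAt ℝ ∞ (fun y => T y (q y)) x := hT.clm_apply hq
    have hne : T x (q x) ≠ 0 := fun h => by simp [h] at hn
    refine ⟨((hTq.norm ℝ hne).inv (norm_ne_zero_iff.2 hne)).smul hq, by rw [hn, inv_one, one_smul],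
      ?_⟩
    filter_upwards [hTq.continuousAt.eventually_ne hne] with y hy
    rw [map_smul, norm_smul, norm_inv, norm_norm, inv_mul_cancel₀ (norm_ne_zero_iff.2 hy)]
  obtain ⟨c₀, v₀, m₀⟩ := normalize q₀ h₀ hn₀
  set e₀ : E → E := fun y => ‖T y (q₀ y)‖⁻¹ • q₀ y with he₀
  have hx₀ : e₀ x = q₀ x := v₀
  let p : E → E := fun y => q₁ y - (inner ℝ (T y (e₀ y)) (T y (q₁ y)) : ℝ) • e₀ y
  have hp : ContDiffAt ℝ ∞ p x :=
    h₁.sub (((hT.clm_apply c₀).inner ℝ (hT.clm_apply h₁)).smul c₀)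
  have hpx : p x = q₁ x := by simp [p, hx₀, hi]
  obtain ⟨c₁, v₁, m₁⟩ := normalize p hp (by rw [hpx, hn₁])
  have hs₀ : ∀ y, e₀ y ∈ Submodule.span ℝ {q₀ y, q₁ y} := fun y =>
    Submodule.smul_mem _ _ (Submodule.subset_span (by simp))
  have hsp : ∀ y, p y ∈ Submodule.span ℝ {q₀ y, q₁ y} := fun y =>
    Submodule.sub_mem _ (Submodule.subset_span (by simp)) (Submodule.smul_mem _ _ (hs₀ y))
  refine ⟨e₀, fun y => ‖T y (p y)‖⁻¹ • p y, c₀, c₁, hx₀, v₁.trans hpx,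
    fun y => ⟨hs₀ y, Submodule.smul_mem _ _ (hsp y)⟩, ?_⟩
  filter_upwards [m₀, m₁] with y hy₀ hy₁
  refine ⟨hy₀, hy₁, ?_⟩
  have hy₀' : ‖T y (e₀ y)‖ = 1 := hy₀
  rw [(T y).map_smul (‖T y (p y)‖⁻¹), real_inner_smul_right]
  simp only [p, map_sub, map_smul, inner_sub_right, real_inner_smul_right,
    real_inner_self_eq_norm_sq, hy₀']
  ring

/-- The second fundamental form of an immersion of an open subset of `ℝ⁴`. -/
def localII (F : V4 → W) (x : V4) : V4 →L[ℝ] V4 →L[ℝ] W :=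
  (ContinuousLinearMap.compL ℝ V4 W W
    (LinearMap.range (fderiv ℝ F x).toLinearMap)ᗮ.starProjection).comp (fderiv ℝ (fderiv ℝ F) x)

theorem localII_apply (F : V4 → W) (x u v : V4) : localII F x u v =
    (LinearMap.range (fderiv ℝ F x).toLinearMap)ᗮ.starProjection
      (fderiv ℝ (fderiv ℝ F) x u v) := rfl

theorem inner_localII {F : V4 → W} {x : V4} {ξ : W}
    (hξ : ξ ∈ (LinearMap.range (fderiv ℝ F x).toLinearMap)ᗮ) (u v : V4) :
    inner ℝ ξ (localII F x u v) = (inner ℝ ξ (fderiv ℝ (fderiv ℝ F) x u v) : ℝ) := by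
  rw [localII_apply, ← Submodule.inner_starProjection_left_eq_right,
    Submodule.starProjection_eq_self_iff.2 hξ]

theorem localII_mem (F : V4 → W) (x u v : V4) :
    localII F x u v ∈ (LinearMap.range (fderiv ℝ F x).toLinearMap)ᗮ :=
  Submodule.starProjection_apply_mem _ _

theorem localII_symm {F : V4 → W} {x : V4} (hF : ContDiffAt ℝ ∞ F x) (u v : V4) :
    localII F x u v = localII F x v u := by
  rw [localII_apply, localII_apply,
    (hF.isSymmSndFDerivAt (by simp only [minSmoothness_of_isRCLikeNormedField]; exact WithTop.coe_le_coe.2 le_top)).eq]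

/-- An orthonormal tangent frame in which the second fundamental form takes values in `QB`. -/
structure IsAdaptedFrame (F : V4 → W) (x : V4) (c : Fin 4 → V4) : Prop where
  orthonormal : Orthonormal ℝ (fun i => fderiv ℝ F x (c i))
  II_01 : localII F x (c 0) (c 1) = 0
  II_23 : localII F x (c 2) (c 3) = 0
  II_11 : localII F x (c 1) (c 1) = localII F x (c 0) (c 0)
  II_22 : localII F x (c 2) (c 2) = -localII F x (c 0) (c 0)
  II_33 : localII F x (c 3) (c 3) = -localII F x (c 0) (c 0)

/-- The normal vectors that represent the second fundamental form in an adapted frame. -/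
def frameNormals (F : V4 → W) (x : V4) (c : Fin 4 → V4) : Fin 5 → W :=
  ![localII F x (c 0) (c 2), localII F x (c 0) (c 3), localII F x (c 1) (c 2),
    localII F x (c 1) (c 3), localII F x (c 0) (c 0)]

theorem frameNormals_mem (F : V4 → W) (x : V4) (c : Fin 4 → V4) (a : Fin 5) :
    frameNormals F x c a ∈ (LinearMap.range (fderiv ℝ F x).toLinearMap)ᗮ := by
  fin_cases a <;> exact localII_mem _ _ _ _

theorem inner_frameNormals (F : V4 → W) (x : V4) (c : Fin 4 → V4) (a : Fin 5) (v : V4) :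
    inner ℝ (fderiv ℝ F x v) (frameNormals F x c a) = (0 : ℝ) :=
  (Submodule.mem_orthogonal _ _).1 (frameNormals_mem F x c a) _ ⟨v, rfl⟩

namespace IsAdaptedFrame

variable {F : V4 → W} {x : V4} {c : Fin 4 → V4}

theorem II_eq (h : IsAdaptedFrame F x c) (hF : ContDiffAt ℝ ∞ F x) (i j : Fin 4) :
    localII F x (c i) (c j) = ∑ a, basisQB a i j • frameNormals F x c a := by
  have s := fun i j => localII_symm hF (c i) (c j)
  fin_cases i <;> fin_cases j <;>
    simp [Fin.sum_univ_five, basisQB, frameNormals, h.II_01, h.II_23, h.II_11, h.II_22, h.II_33,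
      s 1 0, s 2 0, s 3 0, s 2 1, s 3 1, s 3 2]

theorem linearIndependent (h : IsAdaptedFrame F x c) : LinearIndependent ℝ c :=
  LinearIndependent.of_comp (fderiv ℝ F x).toLinearMap h.orthonormal.linearIndependent

/-- Exchanging the two planes replaces `II(c_0, c_0)` by its negative and preserves the block form.
This absorbs the sign ambiguity of the involution. -/
theorem swap (h : IsAdaptedFrame F x c) : IsAdaptedFrame F x ![c 2, c 3, c 0, c 1] where
  orthonormal := by
    have : (fun i => fderiv ℝ F x (![c 2, c 3, c 0, c 1] i)) =
        (fun i => fderiv ℝ F x (c i)) ∘ (![2, 3, 0, 1] : Fin 4 → Fin 4) := by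
      funext i
      fin_cases i <;> rfl
    rw [this]
    exact h.orthonormal.comp _ (by decide)
  II_01 := h.II_23
  II_23 := h.II_01
  II_11 := h.II_33.trans h.II_22.symm
  II_22 := by simp [h.II_22]
  II_33 := by simp [h.II_11, h.II_22]

/-- Only the two planes matter: on `span {c_0, c_1}` the form `II` is the induced metric times
`II(c_0, c_0)`, and on `span {c_2, c_3}` it is minus that. Orthonormal bases of the planes are
therefore equally adapted. -/
theorem of_mem_span (h : IsAdaptedFrame F x c) (hF : ContDiffAt ℝ ∞ F x) {v : Fin 4 → V4}
    (h0 : v 0 ∈ Submodule.span ℝ {c 0, c 1}) (h1 : v 1 ∈ Submodule.span ℝ {c 0, c 1})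
    (h2 : v 2 ∈ Submodule.span ℝ {c 2, c 3}) (h3 : v 3 ∈ Submodule.span ℝ {c 2, c 3})
    (hn : ∀ i, ‖fderiv ℝ F x (v i)‖ = 1)
    (h01 : inner ℝ (fderiv ℝ F x (v 0)) (fderiv ℝ F x (v 1)) = (0 : ℝ))
    (h23 : inner ℝ (fderiv ℝ F x (v 2)) (fderiv ℝ F x (v 3)) = (0 : ℝ)) :
    IsAdaptedFrame F x v := by
  obtain ⟨a0, b0, e0⟩ := Submodule.mem_span_pair.1 h0
  obtain ⟨a1, b1, e1⟩ := Submodule.mem_span_pair.1 h1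
  obtain ⟨a2, b2, e2⟩ := Submodule.mem_span_pair.1 h2
  obtain ⟨a3, b3, e3⟩ := Submodule.mem_span_pair.1 h3
  have ho : ∀ i j, inner ℝ (fderiv ℝ F x (c i)) (fderiv ℝ F x (c j)) =
      if i = j then (1 : ℝ) else 0 := orthonormal_iff_ite.1 h.orthonormal
  have s10 : localII F x (c 1) (c 0) = 0 := (localII_symm hF _ _).trans h.II_01
  have s32 : localII F x (c 3) (c 2) = 0 := (localII_symm hF _ _).trans h.II_23
  have hn' : ∀ i, inner ℝ (fderiv ℝ F x (v i)) (fderiv ℝ F x (v i)) = (1 : ℝ) := fun i => by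
    rw [real_inner_self_eq_norm_sq, hn, one_pow]
  have n0 := hn' 0
  have n1 := hn' 1
  have n2 := hn' 2
  have n3 := hn' 3
  have c01 := h01
  have c23 := h23
  rw [← e0] at n0 h01
  rw [← e1] at n1 h01
  rw [← e2] at n2 h23
  rw [← e3] at n3 h23
  simp only [map_add, map_smul, inner_add_left, inner_add_right, real_inner_smul_left,
    real_inner_smul_right, ho] at n0 n1 n2 n3 h01 h23
  simp only [Fin.isValue, Fin.reduceEq, ↓reduceIte, mul_zero, mul_one, add_zero, zero_add,
    zero_ne_one, one_ne_zero] at n0 n1 n2 n3 h01 h23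
  have expand : ∀ (a b a' b' : ℝ) (i j : Fin 4), localII F x (c i) (c j) = 0 →
      localII F x (c j) (c i) = 0 → localII F x (c i) (c i) = localII F x (c j) (c j) →
      localII F x (a • c i + b • c j) (a' • c i + b' • c j) =
        (a * a' + b * b') • localII F x (c i) (c i) := by
    intro a b a' b' i j hij hji hii
    simp only [map_add, map_smul, add_apply, smul_apply, hij, hji, ← hii]
    module
  refine ⟨?_, ?_, ?_, ?_, ?_, ?_⟩
  · rw [orthonormal_iff_ite]
    have cross : ∀ (a b a' b' : ℝ), inner ℝ (fderiv ℝ F x (a • c 0 + b • c 1))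
        (fderiv ℝ F x (a' • c 2 + b' • c 3)) = (0 : ℝ) := by
      intro a b a' b'
      simp only [map_add, map_smul, inner_add_left, inner_add_right, real_inner_smul_left,
        real_inner_smul_right, ho]
      simp only [Fin.isValue, Fin.reduceEq, ↓reduceIte, mul_zero, add_zero]
    have c02 := cross a0 b0 a2 b2
    have c03 := cross a0 b0 a3 b3
    have c12 := cross a1 b1 a2 b2
    have c13 := cross a1 b1 a3 b3
    rw [e0, e2] at c02
    rw [e0, e3] at c03
    rw [e1, e2] at c12
    rw [e1, e3] at c13
    intro i j
    fin_cases i <;> fin_cases j <;>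
      simp [hn, c01, c02, c03, c12, c13, c23, real_inner_comm (fderiv ℝ F x (v 0)),
        real_inner_comm (fderiv ℝ F x (v 1)) (fderiv ℝ F x (v 2)),
        real_inner_comm (fderiv ℝ F x (v 1)) (fderiv ℝ F x (v 3)),
        real_inner_comm (fderiv ℝ F x (v 2)) (fderiv ℝ F x (v 3))]
  · rw [← e0, ← e1, expand _ _ _ _ _ _ h.II_01 s10 h.II_11.symm,
      show a0 * a1 + b0 * b1 = 0 by linarith, zero_smul]
  · rw [← e2, ← e3, expand _ _ _ _ _ _ h.II_23 s32 (h.II_22.trans h.II_33.symm),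
      show a2 * a3 + b2 * b3 = 0 by linarith, zero_smul]
  · rw [← e0, ← e1, expand _ _ _ _ _ _ h.II_01 s10 h.II_11.symm,
      expand _ _ _ _ _ _ h.II_01 s10 h.II_11.symm, show a1 * a1 + b1 * b1 = 1 by linarith,
      show a0 * a0 + b0 * b0 = 1 by linarith]
  · rw [← e0, ← e2, expand _ _ _ _ _ _ h.II_01 s10 h.II_11.symm,
      expand _ _ _ _ _ _ h.II_23 s32 (h.II_22.trans h.II_33.symm), h.II_22,
      show a2 * a2 + b2 * b2 = 1 by linarith, show a0 * a0 + b0 * b0 = 1 by linarith,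
      one_smul, one_smul]
  · rw [← e0, ← e3, expand _ _ _ _ _ _ h.II_01 s10 h.II_11.symm,
      expand _ _ _ _ _ _ h.II_23 s32 (h.II_22.trans h.II_33.symm), h.II_22,
      show a3 * a3 + b3 * b3 = 1 by linarith, show a0 * a0 + b0 * b0 = 1 by linarith,
      one_smul, one_smul]

end IsAdaptedFrame

end LocalGeometry

/-! ### The splitting operator of the shape operators: smoothness and eigenspaces -/

section SmoothFrame

open scoped Topology

theorem contDiffAt_matrix_mul {ι E : Type*} [Fintype ι] [NormedAddCommGroup E]
    [NormedSpace ℝ E] {A B : E → Matrix ι ι ℝ} {x : E} {k : WithTop ℕ∞}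
    (hA : ∀ i j, ContDiffAt ℝ k (fun y => A y i j) x)
    (hB : ∀ i j, ContDiffAt ℝ k (fun y => B y i j) x) (i j : ι) :
    ContDiffAt ℝ k (fun y => (A y * B y) i j) x := by
  simp only [Matrix.mul_apply]
  exact ContDiffAt.sum fun l _ => (hA i l).mul (hB l j)

theorem contDiffAt_matrix_trace {ι E : Type*} [Fintype ι] [NormedAddCommGroup E]
    [NormedSpace ℝ E] {A : E → Matrix ι ι ℝ} {x : E} {k : WithTop ℕ∞}
    (hA : ∀ i j, ContDiffAt ℝ k (fun y => A y i j) x) :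
    ContDiffAt ℝ k (fun y => (A y).trace) x :=
  ContDiffAt.sum fun i _ => hA i i

theorem contDiffAt_splitting {E : Type*} [NormedAddCommGroup E] [NormedSpace ℝ E]
    {A : E → Fin 5 → Mat4} {X : E → Mat4} {x : E} {k : WithTop ℕ∞}
    (hA : ∀ a i j, ContDiffAt ℝ k (fun y => A y a i j) x)
    (hX : ∀ i j, ContDiffAt ℝ k (fun y => X y i j) x) (h : (traceGram (A x)).det ≠ 0)
    (i j : Fin 4) : ContDiffAt ℝ k (fun y => splitting (A y) (X y) i j) x := by
  have hG : ∀ a b, ContDiffAt ℝ k (fun y => (traceGram (A y))⁻¹ a b) x :=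
    contDiffAt_matrix_inv (fun a b => contDiffAt_matrix_trace
      (contDiffAt_matrix_mul (hA a) (hA b))) h
  have hL : ContDiffAt ℝ k (fun y => traceContraction (A y) (X y) i j) x := by
    simp only [traceContraction, Matrix.sum_apply, Matrix.smul_apply, smul_eq_mul]
    exact ContDiffAt.sum fun a _ => ContDiffAt.sum fun b _ => (hG a b).mul
      (contDiffAt_matrix_mul (contDiffAt_matrix_mul (hA a) hX) (hA b) i j)
  simp only [splitting, Matrix.add_apply, Matrix.sub_apply, Matrix.smul_apply, smul_eq_mul]
  exact ((contDiffAt_const.mul (hX i j)).sub hL).add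
    ((contDiffAt_const.mul (contDiffAt_matrix_trace hX)).mul contDiffAt_const)

variable {W : Type*} [NormedAddCommGroup W] [InnerProductSpace ℝ W]

/-- The matrix of the induced metric. -/
def inducedMetric (F : V4 → W) (b : Fin 4 → V4) (x : V4) : Mat4 :=
  Matrix.gram ℝ fun i => fderiv ℝ F x (b i)

/-- The matrix of the shape operator of a normal vector. -/
def shapeMatrix (F : V4 → W) (b : Fin 4 → V4) (x : V4) (ξ : W) : Mat4 :=
  (inducedMetric F b x)⁻¹ * Matrix.of fun i j => inner ℝ ξ (fderiv ℝ (fderiv ℝ F) x (b i) (b j))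

variable {F : V4 → W} {x : V4}

/-- Let `C` express the adapted frame in the fixed basis. Orthonormality gives `C⁻¹ = Cᵀ g`, so `g⁻¹
Y = C (Cᵀ Y C) C⁻¹`. For shape operators `Cᵀ Y C` lies in `QB`; for the argument `g⁻¹ S^4` it is
symmetric, as `splitting_of_conj` requires. -/
theorem IsAdaptedFrame.splitting_shapeMatrix {c : Fin 4 → V4} (h : IsAdaptedFrame F x c)
    (hF : ContDiffAt ℝ ∞ F x) (b : Module.Basis (Fin 4) ℝ V4) {ξ : Fin 5 → W}
    (hξ : ∀ a, ξ a ∈ (LinearMap.range (fderiv ℝ F x).toLinearMap)ᗮ)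
    (hG : (traceGram fun a => shapeMatrix F b x (ξ a)).det ≠ 0) :
    ∃ (C D : Mat4) (t : ℝ), D * C = 1 ∧ (∀ i, c i = ∑ k, C k i • b k) ∧
      splitting (fun a => shapeMatrix F b x (ξ a)) ((inducedMetric F b x)⁻¹ * basisQB 4) =
        t • (C * basisQB 4 * D) := by
  let C : Mat4 := Matrix.of fun k i => b.repr (c i) k
  have hc : ∀ i, c i = ∑ k, C k i • b k := fun i => (b.sum_repr (c i)).symm
  let g := inducedMetric F b x
  let H : Fin 5 → Mat4 := fun a =>
    Matrix.of fun i j => inner ℝ (ξ a) (fderiv ℝ (fderiv ℝ F) x (b i) (b j))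
  have hDC : C.transpose * g * C = 1 := by
    ext i j
    rw [Matrix.one_apply, ← orthonormal_iff_ite.1 h.orthonormal i j, hc i, hc j]
    simp only [map_sum, map_smul, inner_sum, sum_inner, real_inner_smul_left,
      real_inner_smul_right, Matrix.mul_apply, Matrix.transpose_apply, g, inducedMetric,
      Matrix.gram_apply, Finset.sum_mul]
    exact Finset.sum_congr rfl fun k _ => Finset.sum_congr rfl fun l _ => by ring
  have hH : ∀ a, C.transpose * H a * C =
      ∑ d, (inner ℝ (ξ a) (frameNormals F x c d) : ℝ) • basisQB d := by
    intro a
    ext i j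
    have : inner ℝ (ξ a) (fderiv ℝ (fderiv ℝ F) x (c i) (c j)) =
        ∑ d, (inner ℝ (ξ a) (frameNormals F x c d) : ℝ) * basisQB d i j := by
      rw [← inner_localII (hξ a), h.II_eq hF, inner_sum]
      exact Finset.sum_congr rfl fun d _ => by rw [real_inner_smul_right, mul_comm]
    rw [Matrix.sum_apply]
    simp only [Matrix.smul_apply, smul_eq_mul]
    rw [← this, hc i, hc j]
    simp only [map_sum, map_smul, sum_apply, smul_apply, inner_sum, real_inner_smul_right,
      Matrix.mul_apply, Matrix.transpose_apply, H, Matrix.of_apply, Finset.sum_mul, Finset.mul_sum]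
    exact Finset.sum_congr rfl fun k _ => Finset.sum_congr rfl fun l _ => by ring
  have hCD : C * (C.transpose * g) = 1 := mul_eq_one_comm.1 hDC
  have hg : g⁻¹ = C * C.transpose :=
    Matrix.inv_eq_left_inv (by rw [Matrix.mul_assoc, hCD])
  have conj : ∀ Y : Mat4, g⁻¹ * Y = C * (C.transpose * Y * C) * (C.transpose * g) := fun Y => by
    rw [hg]
    calc C * C.transpose * Y = C * C.transpose * Y * (C * (C.transpose * g)) := by
          rw [hCD, Matrix.mul_one]
      _ = _ := by simp only [Matrix.mul_assoc]
  have hsymm : (C.transpose * basisQB 4 * C).IsSymm := by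
    have : (basisQB 4).transpose = basisQB 4 := by
      ext i j
      fin_cases i <;> fin_cases j <;> simp [basisQB]
    rw [Matrix.IsSymm, Matrix.transpose_mul, Matrix.transpose_mul, Matrix.transpose_transpose, this,
      Matrix.mul_assoc]
  have key := splitting_of_conj (M := Matrix.of fun a d => inner ℝ (ξ a) (frameNormals F x c d))
    hDC (A := fun a => shapeMatrix F b x (ξ a)) (fun a => by
      simp only [Matrix.of_apply]
      rw [← hH, ← conj]
      rfl) hG hsymm
  rw [← conj] at key
  exact ⟨C, C.transpose * g, _, hDC, hc, key⟩

theorem sum_mul_smul_basis {C N : Mat4} {b c : Fin 4 → V4} (hc : ∀ i, c i = ∑ k, C k i • b k)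
    (i : Fin 4) : ∑ k, (C * N) k i • b k = ∑ m, N m i • c m := by
  simp only [hc, Finset.smul_sum, Matrix.mul_apply, Finset.sum_smul, smul_smul]
  rw [Finset.sum_comm]
  exact Finset.sum_congr rfl fun m _ => Finset.sum_congr rfl fun k _ => by rw [mul_comm]

/-- The matrices `1 ± C S^4 C⁻¹` are twice the projections onto the planes spanned by the two halves
of `c`. -/
theorem mem_span_of_projection {C D : Mat4} (hDC : D * C = 1) {b c : Fin 4 → V4}
    (hc : ∀ i, c i = ∑ k, C k i • b k) (i : Fin 4) :
    ∑ k, (1 + C * basisQB 4 * D) k i • b k ∈ Submodule.span ℝ {c 0, c 1} ∧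
      ∑ k, (1 - C * basisQB 4 * D) k i • b k ∈ Submodule.span ℝ {c 2, c 3} := by
  have hCD : C * D = 1 := mul_eq_one_comm.1 hDC
  have e1 : 1 + C * basisQB 4 * D = C * ((1 + basisQB 4) * D) := by
    rw [Matrix.add_mul, Matrix.mul_add, Matrix.one_mul, hCD, Matrix.mul_assoc]
  have e2 : 1 - C * basisQB 4 * D = C * ((1 - basisQB 4) * D) := by
    rw [Matrix.sub_mul, Matrix.mul_sub, Matrix.one_mul, hCD, Matrix.mul_assoc]
  rw [e1, e2, sum_mul_smul_basis hc, sum_mul_smul_basis hc]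
  constructor
  · refine Submodule.mem_span_pair.2 ⟨((1 + basisQB 4) * D) 0 i, ((1 + basisQB 4) * D) 1 i, ?_⟩
    have h2 : ((1 + basisQB 4) * D) 2 i = 0 := by
      simp [Matrix.mul_apply, Fin.sum_univ_four, basisQB, Matrix.one_apply]
    have h3 : ((1 + basisQB 4) * D) 3 i = 0 := by
      simp [Matrix.mul_apply, Fin.sum_univ_four, basisQB, Matrix.one_apply]
    rw [Fin.sum_univ_four, h2, h3, zero_smul, zero_smul, add_zero, add_zero]
  · refine Submodule.mem_span_pair.2 ⟨((1 - basisQB 4) * D) 2 i, ((1 - basisQB 4) * D) 3 i, ?_⟩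
    have h0 : ((1 - basisQB 4) * D) 0 i = 0 := by
      simp [Matrix.mul_apply, Fin.sum_univ_four, basisQB, Matrix.one_apply]
    have h1 : ((1 - basisQB 4) * D) 1 i = 0 := by
      simp [Matrix.mul_apply, Fin.sum_univ_four, basisQB, Matrix.one_apply]
    rw [Fin.sum_univ_four, h0, h1, zero_smul, zero_smul, zero_add, zero_add]

end SmoothFrame

/-! ### Existence of smooth adapted frames -/

section SmoothFrameExistence

open scoped Topology

variable {W : Type*} [NormedAddCommGroup W] [InnerProductSpace ℝ W] {F : V4 → W} {x₀ : V4}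

theorem contDiffAt_fderiv_infty {E G : Type*} [NormedAddCommGroup E] [NormedSpace ℝ E]
    [NormedAddCommGroup G] [NormedSpace ℝ G] {f : E → G} {x : E} (hf : ContDiffAt ℝ ∞ f x) :
    ContDiffAt ℝ ∞ (fderiv ℝ f) x :=
  hf.fderiv_right (by simp)

/-- Extension of normal vectors to smooth normal fields. -/
theorem exists_normal_extension (hF : ContDiffAt ℝ ∞ F x₀) {b : Module.Basis (Fin 4) ℝ V4}
    (hb : LinearIndependent ℝ fun i => fderiv ℝ F x₀ (b i)) {ξ : W}
    (hξ : ξ ∈ (LinearMap.range (fderiv ℝ F x₀).toLinearMap)ᗮ) :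
    ∃ η : V4 → W, ContDiffAt ℝ ∞ η x₀ ∧ η x₀ = ξ ∧
      ∀ᶠ x in 𝓝 x₀, η x ∈ (LinearMap.range (fderiv ℝ F x).toLinearMap)ᗮ := by
  have hn : ∀ i, ContDiffAt ℝ ∞ (fun x => fderiv ℝ F x (b i)) x₀ := fun i =>
    (contDiffAt_fderiv_infty hF).clm_apply contDiffAt_const
  refine ⟨fun x => ξ - ∑ j, (inner ℝ (dualFrame (fun i => fderiv ℝ F x (b i)) j) ξ : ℝ) •
    fderiv ℝ F x (b j), ?_, ?_, ?_⟩
  · exact contDiffAt_const.sub (ContDiffAt.sum fun j _ =>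
      ((contDiffAt_dualFrame (n := fun x i => fderiv ℝ F x (b i)) hn hb j).inner ℝ
        contDiffAt_const).smul (hn j))
  · have : ∀ j, inner ℝ (dualFrame (fun i => fderiv ℝ F x₀ (b i)) j) ξ = (0 : ℝ) :=
      inner_dualFrame_eq_zero fun i => (Submodule.mem_orthogonal _ _).1 hξ _ ⟨b i, rfl⟩
    simp [this]
  · filter_upwards [eventually_linearIndependent (n := fun x i => fderiv ℝ F x (b i))
      (fun i => (hn i).continuousAt) hb] with x hx
    refine (Submodule.mem_orthogonal _ _).2 ?_
    rintro _ ⟨v, rfl⟩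
    rw [real_inner_comm]
    change inner ℝ _ (fderiv ℝ F x v) = (0 : ℝ)
    conv_lhs => rw [← b.sum_repr v]
    simp only [map_sum, map_smul, inner_sum, real_inner_smul_right]
    exact Finset.sum_eq_zero fun i _ => by rw [inner_sub_sum_dualFrame hx, mul_zero]

/-- The decomposition of the tangent spaces given by adapted frames is smooth. -/
theorem exists_smooth_projection (hF : ∀ᶠ x in 𝓝 x₀, ContDiffAt ℝ ∞ F x)
    (h : ∀ᶠ x in 𝓝 x₀, ∃ c, IsAdaptedFrame F x c) {c₀ : Fin 4 → V4}
    (hc₀ : IsAdaptedFrame F x₀ c₀) (hli : LinearIndependent ℝ (frameNormals F x₀ c₀))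
    {b : Module.Basis (Fin 4) ℝ V4} (hb : ∀ i, b i = c₀ i) :
    ∃ P : V4 → Mat4, (∀ i j, ContDiffAt ℝ ∞ (fun x => P x i j) x₀) ∧ P x₀ = basisQB 4 ∧
      ∀ᶠ x in 𝓝 x₀, ∃ c, IsAdaptedFrame F x c ∧ ∀ i,
        ∑ k, (1 + P x) k i • b k ∈ Submodule.span ℝ {c 0, c 1} ∧
        ∑ k, (1 - P x) k i • b k ∈ Submodule.span ℝ {c 2, c 3} := by
  have hF₀ := hF.self_of_nhds
  have hbo : Orthonormal ℝ fun i => fderiv ℝ F x₀ (b i) := by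
    simpa only [hb] using hc₀.orthonormal
  have hb' : ∀ i, ContDiffAt ℝ ∞ (fun x => fderiv ℝ F x (b i)) x₀ := fun i =>
    (contDiffAt_fderiv_infty hF₀).clm_apply contDiffAt_const
  -- Starting from the dual of the frame normals makes the shape matrices at `x₀` exactly the `S^a`.
  have hext := fun a => exists_normal_extension (ξ := dualFrame (frameNormals F x₀ c₀) a) hF₀
    hbo.linearIndependent
    (Submodule.sum_mem _ fun d _ => Submodule.smul_mem _ _ (frameNormals_mem F x₀ c₀ d))
  choose ξ hξ hξ₀ hξn using hext
  have hg₀ : inducedMetric F b x₀ = 1 := by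
    ext i j
    rw [Matrix.one_apply, ← orthonormal_iff_ite.1 hbo i j]
    rfl
  have hginv : ∀ i j, ContDiffAt ℝ ∞ (fun x => (inducedMetric F b x)⁻¹ i j) x₀ :=
    contDiffAt_gram_inv (n := fun x i => fderiv ℝ F x (b i)) hb' hbo.linearIndependent
  let A : V4 → Fin 5 → Mat4 := fun x a => shapeMatrix F b x (ξ a x)
  have hA : ∀ a i j, ContDiffAt ℝ ∞ (fun x => A x a i j) x₀ := fun a =>
    contDiffAt_matrix_mul hginv fun i j => (hξ a).inner ℝ
      (((contDiffAt_fderiv_infty (contDiffAt_fderiv_infty hF₀)).clm_apply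
        contDiffAt_const).clm_apply contDiffAt_const)
  have hA₀ : A x₀ = basisQB := by
    funext a
    simp only [A, shapeMatrix, hg₀, inv_one, Matrix.one_mul]
    ext i j
    rw [Matrix.of_apply, ← inner_localII (hξn a).self_of_nhds, hξ₀, hb, hb, hc₀.II_eq hF₀,
      inner_sum]
    simp [real_inner_smul_right, inner_dualFrame_self hli]
  have hdet₀ : (traceGram (A x₀)).det ≠ 0 := by
    rw [hA₀, traceGram_basisQB, Matrix.det_diagonal]
    simp [Fin.prod_univ_five]
  have hdet : ∀ᶠ x in 𝓝 x₀, (traceGram (A x)).det ≠ 0 :=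
    (contDiffAt_matrix_det fun a b => contDiffAt_matrix_trace
      (contDiffAt_matrix_mul (hA a) (hA b))).continuousAt.eventually_ne hdet₀
  let X : V4 → Mat4 := fun x => (inducedMetric F b x)⁻¹ * basisQB 4
  have hX : ∀ i j, ContDiffAt ℝ ∞ (fun x => X x i j) x₀ :=
    contDiffAt_matrix_mul hginv fun i j => contDiffAt_const
  let Y : V4 → Mat4 := fun x => splitting (A x) (X x)
  have hY : ∀ i j, ContDiffAt ℝ ∞ (fun x => Y x i j) x₀ := contDiffAt_splitting hA hX hdet₀
  have hY₀ : Y x₀ = basisQB 4 := by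
    simp only [Y, X, hA₀, hg₀, inv_one, Matrix.one_mul]
    rw [splitting_basisQB]
    · have : (basisQB 4 * basisQB 4).trace = 4 := by
        have := congrFun (congrFun traceGram_basisQB 4) 4
        simpa [traceGram] using this
      rw [this]
      norm_num
    · ext i j
      fin_cases i <;> fin_cases j <;> simp [basisQB]
  have hY2 : ContDiffAt ℝ ∞ (fun x => (Y x * Y x) 0 0) x₀ := contDiffAt_matrix_mul hY hY 0 0
  have hYY₀ : (Y x₀ * Y x₀) 0 0 = 1 := by
    rw [hY₀]
    simp [basisQB]
  have hpos : ∀ᶠ x in 𝓝 x₀, 0 < (Y x * Y x) 0 0 :=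
    hY2.continuousAt.eventually_const_lt (hYY₀ ▸ one_pos : (0 : ℝ) < (Y x₀ * Y x₀) 0 0)
  -- `Y` is a scalar `t` times an involution, so `Y² = t²` and any diagonal entry of `Y²` recovers
  -- `|t|` smoothly near `x₀`, where `t² = 1`.
  refine ⟨fun x => (√((Y x * Y x) 0 0))⁻¹ • Y x, fun i j => ?_, ?_, ?_⟩
  · exact ((hY2.sqrt (by rw [hYY₀]; exact one_ne_zero)).inv (by simp [hYY₀])).smul (hY i j)
  · change (√((Y x₀ * Y x₀) 0 0))⁻¹ • Y x₀ = basisQB 4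
    rw [hYY₀, hY₀, Real.sqrt_one, inv_one, one_smul]
  filter_upwards [hF, h, hdet, hpos, Filter.eventually_all.2 hξn] with x hFx hx hdx hpx hξx
  obtain ⟨c, hc⟩ := hx
  obtain ⟨C, D, t, hDC, hcC, hYx⟩ := hc.splitting_shapeMatrix hFx b hξx hdx
  have hYx' : Y x = t • (C * basisQB 4 * D) := hYx
  have hsq : Y x * Y x = (t * t) • 1 := by
    have hP : basisQB 4 * basisQB 4 = 1 := by
      ext i j
      fin_cases i <;> fin_cases j <;> simp [basisQB]
    rw [hYx', smul_mul_smul_comm]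
    congr 1
    calc _ = C * basisQB 4 * (D * C) * basisQB 4 * D := by simp only [Matrix.mul_assoc]
      _ = C * (basisQB 4 * basisQB 4) * D := by
        rw [hDC, Matrix.mul_one]
        simp only [Matrix.mul_assoc]
      _ = 1 := by rw [hP, Matrix.mul_one, mul_eq_one_comm.1 hDC]
  have hr : (Y x * Y x) 0 0 = t * t := by simp [hsq]
  have ht : t ≠ 0 := fun h0 => by simp [hr, h0] at hpx
  rw [hr, Real.sqrt_mul_self_eq_abs, hYx', smul_smul]
  -- The pointwise frames may label the planes in either order; when `t < 0` the swapped frame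
  -- matches `P`.
  rcases ht.lt_or_gt with ht | ht
  · rw [abs_of_neg ht, show (-t)⁻¹ * t = -1 by field_simp]
    refine ⟨_, hc.swap, fun i => ?_⟩
    rw [neg_one_smul, sub_neg_eq_add, ← sub_eq_add_neg]
    exact (mem_span_of_projection hDC hcC i).symm
  · rw [abs_of_pos ht, inv_mul_cancel₀ ht.ne', one_smul]
    exact ⟨c, hc, mem_span_of_projection hDC hcC⟩

/-- Project the constant frame `c₀` to the smooth planes and orthonormalize within each; by
`of_mem_span` the result is adapted. -/
theorem exists_smooth_adaptedFrame (hF : ∀ᶠ x in 𝓝 x₀, ContDiffAt ℝ ∞ F x)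
    (h : ∀ᶠ x in 𝓝 x₀, ∃ c, IsAdaptedFrame F x c) {c₀ : Fin 4 → V4}
    (hc₀ : IsAdaptedFrame F x₀ c₀) (hli : LinearIndependent ℝ (frameNormals F x₀ c₀)) :
    ∃ e : V4 → Fin 4 → V4, (∀ i, ContDiffAt ℝ ∞ (fun x => e x i) x₀) ∧ e x₀ = c₀ ∧
      ∀ᶠ x in 𝓝 x₀, IsAdaptedFrame F x (e x) := by
  have hF₀ := hF.self_of_nhds
  let b := basisOfLinearIndependentOfCardEqFinrank hc₀.linearIndependent (by simp)
  have hb : ∀ i, b i = c₀ i := fun i => by simp [b]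
  obtain ⟨P, hP, hP₀, hspan⟩ := exists_smooth_projection hF h hc₀ hli hb
  -- The entry `basisQB 4 i i = ±1` selects the projection `(1 ± P)/2` onto the plane to which the
  -- index `i` belongs.
  let q : Fin 4 → V4 → V4 := fun i x =>
    ∑ k, ((2⁻¹ : ℝ) * (((1 : Mat4) + basisQB 4 i i • P x) k i)) • b k
  have hq : ∀ i, ContDiffAt ℝ ∞ (q i) x₀ := fun i => ContDiffAt.sum fun k _ =>
    (contDiffAt_const.mul (contDiffAt_const.add (contDiffAt_const.mul (hP k i)))).smul
      contDiffAt_const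
  have hq₀ : ∀ i, q i x₀ = c₀ i := fun i => by
    simp only [q, hP₀, ← hb]
    fin_cases i <;>
      simp [Fin.sum_univ_four, basisQB, Matrix.one_apply] <;> norm_num
  have hqs : ∀ i x, q i x = (2⁻¹ : ℝ) • ∑ k, ((1 : Mat4) + basisQB 4 i i • P x) k i • b k :=
    fun i x => by simp only [q, Finset.smul_sum, smul_smul]
  have hT := contDiffAt_fderiv_infty hF₀
  have hn : ∀ i, ‖fderiv ℝ F x₀ (q i x₀)‖ = 1 := fun i => by
    rw [hq₀]
    exact hc₀.orthonormal.1 i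
  have ho : ∀ i j, i ≠ j → inner ℝ (fderiv ℝ F x₀ (q i x₀)) (fderiv ℝ F x₀ (q j x₀)) = (0 : ℝ) :=
    fun i j hij => by
      rw [hq₀, hq₀]
      exact hc₀.orthonormal.2 hij
  obtain ⟨e0, e1, d0, d1, v0, v1, s01, m01⟩ := exists_orthonormal_pair hT (hq 0) (hq 1)
    (hn 0) (hn 1) (ho 0 1 (by decide))
  obtain ⟨e2, e3, d2, d3, v2, v3, s23, m23⟩ := exists_orthonormal_pair hT (hq 2) (hq 3)
    (hn 2) (hn 3) (ho 2 3 (by decide))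
  refine ⟨fun x => ![e0 x, e1 x, e2 x, e3 x], fun i => ?_, ?_, ?_⟩
  · fin_cases i <;> assumption
  · funext i
    fin_cases i <;> simp [v0, v1, v2, v3, hq₀]
  filter_upwards [hF, hspan, m01, m23] with x hFx hx h01 h23
  obtain ⟨c, hc, hcs⟩ := hx
  have hq0 : ∀ i, basisQB 4 i i = 1 → q i x ∈ Submodule.span ℝ {c 0, c 1} := fun i hi => by
    rw [hqs, hi, one_smul]
    exact Submodule.smul_mem _ _ (hcs i).1
  have hq1 : ∀ i, basisQB 4 i i = -1 → q i x ∈ Submodule.span ℝ {c 2, c 3} := fun i hi => by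
    rw [hqs, hi, neg_one_smul, ← sub_eq_add_neg]
    exact Submodule.smul_mem _ _ (hcs i).2
  have hle0 : Submodule.span ℝ {q 0 x, q 1 x} ≤ Submodule.span ℝ {c 0, c 1} :=
    Submodule.span_le.2 (Set.insert_subset (hq0 0 (by simp [basisQB]))
      (Set.singleton_subset_iff.2 (hq0 1 (by simp [basisQB]))))
  have hle1 : Submodule.span ℝ {q 2 x, q 3 x} ≤ Submodule.span ℝ {c 2, c 3} :=
    Submodule.span_le.2 (Set.insert_subset (hq1 2 (by simp [basisQB]))
      (Set.singleton_subset_iff.2 (hq1 3 (by simp [basisQB]))))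
  refine hc.of_mem_span hFx (hle0 (s01 x).1) (hle0 (s01 x).2) (hle1 (s23 x).1) (hle1 (s23 x).2)
    (fun i => ?_) h01.2.2 h23.2.2
  fin_cases i
  exacts [h01.1, h01.2.1, h23.1, h23.2.1]

end SmoothFrameExistence

/-! ### Moving frames along an immersion -/

section MovingFrame

open scoped Topology

variable {W : Type*} [NormedAddCommGroup W] [InnerProductSpace ℝ W]

/-- The derivative of the `1`-form `⟨u, dv⟩`. -/
theorem fderiv_inner_fderiv {E : Type*} [NormedAddCommGroup E] [NormedSpace ℝ E] {u v : E → W}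
    {x : E} (hu : ContDiffAt ℝ 1 u x) (hv : ContDiffAt ℝ 2 v x) (X Y : E) :
    fderiv ℝ (fun y => (inner ℝ (u y) (fderiv ℝ v y Y) : ℝ)) x X =
      inner ℝ (fderiv ℝ u x X) (fderiv ℝ v x Y) +
        inner ℝ (u x) (fderiv ℝ (fderiv ℝ v) x X Y) := by
  have hv' : DifferentiableAt ℝ (fderiv ℝ v) x :=
    (hv.fderiv_right (m := 1) (by norm_num)).differentiableAt one_ne_zero
  rw [fderiv_inner_apply ℝ (hu.differentiableAt one_ne_zero)
    (hv'.clm_apply (differentiableAt_const Y)), fderiv_clm_apply hv' (differentiableAt_const Y),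
    add_comm]
  simp

theorem sndDeriv_symm {E : Type*} [NormedAddCommGroup E] [NormedSpace ℝ E] {v : E → W} {x : E}
    (hv : ContDiffAt ℝ 2 v x) (X Y : E) :
    fderiv ℝ (fderiv ℝ v) x X Y = fderiv ℝ (fderiv ℝ v) x Y X :=
  (hv.isSymmSndFDerivAt (by simp)).eq X Y

/-- The expansion of a tangent vector in an orthonormal frame of the induced metric. -/
theorem eq_sum_of_orthonormal {L : V4 →L[ℝ] W} {c : Fin 4 → V4}
    (h : Orthonormal ℝ fun i => L (c i)) (Y : V4) :
    Y = ∑ l, (inner ℝ (L (c l)) (L Y) : ℝ) • c l := by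
  have hli : LinearIndependent ℝ c :=
    LinearIndependent.of_comp L.toLinearMap h.linearIndependent
  let b := basisOfLinearIndependentOfCardEqFinrank hli (by simp)
  have hb : ∀ i, b i = c i := fun i => by simp [b]
  have hr : ∀ l, (inner ℝ (L (c l)) (L Y) : ℝ) = b.repr Y l := fun l => by
    conv_lhs => rw [← b.sum_repr Y]
    simp only [map_sum, map_smul, inner_sum, real_inner_smul_right, hb,
      orthonormal_iff_ite.1 h]
    simp
  exact (b.sum_repr Y).symm.trans (Finset.sum_congr rfl fun l _ => by rw [hr, hb])

/-- The tangent frame of the image. -/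
def tangentFrame (F : V4 → W) (e : V4 → Fin 4 → V4) (x : V4) (i : Fin 4) : W :=
  fderiv ℝ F x (e x i)

/-- The frame `(e, n)` is orthonormal and normal at `x`, and the second fundamental form of `F`
at `x` is `S^a n_a`. -/
structure IsMovingFrame (F : V4 → W) (e : V4 → Fin 4 → V4) (n : V4 → Fin 5 → W) (x : V4) :
    Prop where
  contDiff : ContDiffAt ℝ 3 F x
  contDiff_e : ∀ i, ContDiffAt ℝ 2 (fun y => e y i) x
  contDiff_n : ∀ a, ContDiffAt ℝ 2 (fun y => n y a) x
  orthonormal : Orthonormal ℝ (tangentFrame F e x)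
  inner_e_n : ∀ i a, inner ℝ (tangentFrame F e x i) (n x a) = (0 : ℝ)
  linearIndependent : LinearIndependent ℝ (n x)
  deriv_eq : ∀ i Y, fderiv ℝ (fun y => tangentFrame F e y i) x Y =
    ∑ j, (inner ℝ (tangentFrame F e x j) (fderiv ℝ (fun y => tangentFrame F e y i) x Y) : ℝ) •
        tangentFrame F e x j +
      ∑ a, (∑ j, basisQB a i j * inner ℝ (tangentFrame F e x j) (fderiv ℝ F x Y)) • n x a

variable {F : V4 → W} {e : V4 → Fin 4 → V4} {n : V4 → Fin 5 → W} {x : V4}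

namespace IsMovingFrame

theorem contDiff_tangentFrame (h : IsMovingFrame F e n x) (i : Fin 4) :
    ContDiffAt ℝ 2 (fun y => tangentFrame F e y i) x :=
  (h.contDiff.fderiv_right (by norm_num)).clm_apply (h.contDiff_e i)

theorem inner_tangentFrame (h : IsMovingFrame F e n x) (i j : Fin 4) :
    inner ℝ (tangentFrame F e x i) (tangentFrame F e x j) = if i = j then (1 : ℝ) else 0 :=
  orthonormal_iff_ite.1 h.orthonormal i j

theorem eq_sum (h : IsMovingFrame F e n x) (Y : V4) :
    Y = ∑ l, (inner ℝ (tangentFrame F e x l) (fderiv ℝ F x Y) : ℝ) • e x l :=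
  eq_sum_of_orthonormal h.orthonormal Y

theorem deriv_eq_frame (h : IsMovingFrame F e n x) (i l : Fin 4) :
    fderiv ℝ (fun y => tangentFrame F e y i) x (e x l) =
    ∑ j, (inner ℝ (tangentFrame F e x j)
        (fderiv ℝ (fun y => tangentFrame F e y i) x (e x l)) : ℝ) • tangentFrame F e x j +
      ∑ a, basisQB a i l • n x a := by
  have hs : ∀ a, ∑ j, basisQB a i j * inner ℝ (tangentFrame F e x j) (fderiv ℝ F x (e x l)) =
      basisQB a i l := fun a => by
    change ∑ j, basisQB a i j * inner ℝ (tangentFrame F e x j) (tangentFrame F e x l) = _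
    simp [h.inner_tangentFrame]
  conv_lhs => rw [h.deriv_eq i (e x l)]
  simp only [hs]

theorem inner_fderiv_tangentFrame (h : ∀ᶠ y in 𝓝 x, IsMovingFrame F e n y) (i j : Fin 4) (Y : V4) :
    inner ℝ (fderiv ℝ (fun y => tangentFrame F e y i) x Y) (tangentFrame F e x j) +
      inner ℝ (tangentFrame F e x i) (fderiv ℝ (fun y => tangentFrame F e y j) x Y) =
        (0 : ℝ) := by
  have hx := h.self_of_nhds
  have heq : (fun y => (inner ℝ (tangentFrame F e y i) (tangentFrame F e y j) : ℝ)) =ᶠ[𝓝 x]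
      fun _ => if i = j then (1 : ℝ) else 0 := by
    filter_upwards [h] with y hy using hy.inner_tangentFrame i j
  have h' := congrArg (fun L : V4 →L[ℝ] ℝ => L Y) heq.fderiv_eq
  simp only [fderiv_fun_const] at h'
  rw [fderiv_inner_apply ℝ ((hx.contDiff_tangentFrame i).differentiableAt two_ne_zero)
    ((hx.contDiff_tangentFrame j).differentiableAt two_ne_zero)] at h'
  rw [add_comm]
  exact h'

theorem inner_fderiv_normal (h : ∀ᶠ y in 𝓝 x, IsMovingFrame F e n y) (i : Fin 4) (a : Fin 5) (Y : V4) :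
    inner ℝ (fderiv ℝ (fun y => tangentFrame F e y i) x Y) (n x a) +
      inner ℝ (tangentFrame F e x i) (fderiv ℝ (fun y => n y a) x Y) = (0 : ℝ) := by
  have hx := h.self_of_nhds
  have heq : (fun y => (inner ℝ (tangentFrame F e y i) (n y a) : ℝ)) =ᶠ[𝓝 x] fun _ => 0 := by
    filter_upwards [h] with y hy using hy.inner_e_n i a
  have h' := congrArg (fun L : V4 →L[ℝ] ℝ => L Y) heq.fderiv_eq
  simp only [fderiv_fun_const] at h'
  rw [fderiv_inner_apply ℝ ((hx.contDiff_tangentFrame i).differentiableAt two_ne_zero)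
    ((hx.contDiff_n a).differentiableAt two_ne_zero)] at h'
  rw [add_comm]
  exact h'

/-- The first-order data of a moving frame. -/
def jet (h : ∀ᶠ y in 𝓝 x, IsMovingFrame F e n y) : FrameJet W :=
  have hx := h.self_of_nhds
  frameJet (e := tangentFrame F e) (n := n) (fun a => (hx.contDiff_n a).of_le one_le_two)
    hx.linearIndependent hx.orthonormal hx.inner_e_n
    (fun i => fderiv ℝ (fun y => tangentFrame F e y i) x) (fun a => fderiv ℝ (fun y => n y a) x)
    (fun _ => rfl) (e x) (fun i j _ => inner_fderiv_tangentFrame h i j _)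
    (fun i b _ => inner_fderiv_normal h i b _) hx.deriv_eq_frame

theorem contDiff_dual (hx : IsMovingFrame F e n x) (a : Fin 5) :
    ContDiffAt ℝ 1 (fun y => dualFrame (n y) a) x :=
  contDiffAt_dualFrame (fun a => (hx.contDiff_n a).of_le one_le_two) hx.linearIndependent a

theorem inner_dual_deriv (hx : IsMovingFrame F e n x) (a : Fin 5) (i : Fin 4) (Y : V4) :
    inner ℝ (dualFrame (n x) a) (fderiv ℝ (fun y => tangentFrame F e y i) x Y) =
      ∑ j, basisQB a i j * (inner ℝ (tangentFrame F e x j) (fderiv ℝ F x Y) : ℝ) := by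
  have hde : ∀ j, (inner ℝ (dualFrame (n x) a) (tangentFrame F e x j) : ℝ) = 0 := fun j =>
    inner_dualFrame_eq_zero (fun b => by rw [real_inner_comm, hx.inner_e_n]) a
  rw [hx.deriv_eq i Y, inner_add_right, inner_sum, inner_sum]
  simp [real_inner_smul_right, hde, inner_dualFrame_self hx.linearIndependent]

/-- Differentiate `⟨d^a, de_i⟩ = S^a_ij ω^j`, valid near `x`, and antisymmetrize: the second
derivatives of `e_i` and of `F` drop out by symmetry. -/
theorem jet_isIntegral (h : ∀ᶠ y in 𝓝 x, IsMovingFrame F e n y) : (jet h).IsIntegral := by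
  intro a i l k
  have hx := h.self_of_nhds
  have key : ∀ X Y : V4,
      inner ℝ (fderiv ℝ (fun y => dualFrame (n y) a) x X)
          (fderiv ℝ (fun y => tangentFrame F e y i) x Y) +
        inner ℝ (dualFrame (n x) a)
          (fderiv ℝ (fderiv ℝ (fun y => tangentFrame F e y i)) x X Y) =
      ∑ j, basisQB a i j * (inner ℝ (fderiv ℝ (fun y => tangentFrame F e y j) x X)
        (fderiv ℝ F x Y) + inner ℝ (tangentFrame F e x j) (fderiv ℝ (fderiv ℝ F) x X Y) : ℝ) := by
    intro X Y
    have heq : (fun y => (inner ℝ (dualFrame (n y) a)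
        (fderiv ℝ (fun y => tangentFrame F e y i) y Y) : ℝ)) =ᶠ[𝓝 x] fun y =>
        ∑ j, basisQB a i j * (inner ℝ (tangentFrame F e y j) (fderiv ℝ F y Y) : ℝ) := by
      filter_upwards [h] with y hy using hy.inner_dual_deriv a i Y
    have h' := congrArg (fun L : V4 →L[ℝ] ℝ => L X) heq.fderiv_eq
    beta_reduce at h'
    have hF2 : ContDiffAt ℝ 2 F x := hx.contDiff.of_le (by norm_num)
    have hd : ∀ j, DifferentiableAt ℝ (fun y =>
        (inner ℝ (tangentFrame F e y j) (fderiv ℝ F y Y) : ℝ)) x := fun j =>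
      ((hx.contDiff_tangentFrame j).differentiableAt two_ne_zero).inner ℝ
        (((hF2.fderiv_right (m := 1) (by norm_num)).differentiableAt one_ne_zero).clm_apply
          (differentiableAt_const Y))
    rw [fderiv_inner_fderiv (hx.contDiff_dual a) (hx.contDiff_tangentFrame i),
      fderiv_fun_sum fun j _ => (hd j).const_mul _, sum_apply] at h'
    rw [h']
    refine Finset.sum_congr rfl fun j _ => ?_
    rw [fderiv_const_mul (hd j), smul_apply, smul_eq_mul,
      fderiv_inner_fderiv ((hx.contDiff_tangentFrame j).of_le one_le_two) hF2]
  have k1 := key (e x l) (e x k)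
  have k2 := key (e x k) (e x l)
  rw [sndDeriv_symm (hx.contDiff_tangentFrame i)] at k1
  rw [Finset.sum_congr rfl fun j _ => by
    rw [sndDeriv_symm (hx.contDiff.of_le (by norm_num)) (e x l) (e x k)]] at k1
  simp only [mul_add, Finset.sum_add_distrib] at k1 k2
  simp only [mul_sub, Finset.sum_sub_distrib]
  change inner ℝ (fderiv ℝ (fun y => dualFrame (n y) a) x (e x l))
      (fderiv ℝ (fun y => tangentFrame F e y i) x (e x k)) -
    inner ℝ (fderiv ℝ (fun y => dualFrame (n y) a) x (e x k))
      (fderiv ℝ (fun y => tangentFrame F e y i) x (e x l)) =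
    ∑ j, basisQB a i j * (inner ℝ (fderiv ℝ (fun y => tangentFrame F e y j) x (e x l))
      (fderiv ℝ F x (e x k)) : ℝ) -
    ∑ j, basisQB a i j * (inner ℝ (fderiv ℝ (fun y => tangentFrame F e y j) x (e x k))
      (fderiv ℝ F x (e x l)) : ℝ)
  linarith

/-- The relations between the connection forms, as identities of `1`-forms. -/
theorem connection_forms (h : ∀ᶠ y in 𝓝 x, IsMovingFrame F e n y) (Y : V4) :
    (inner ℝ (dualFrame (n x) 4) (fderiv ℝ (fun y => n y 0) x Y) : ℝ) =
      2 * inner ℝ (tangentFrame F e x 0) (fderiv ℝ (fun y => tangentFrame F e y 2) x Y) ∧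
    (inner ℝ (dualFrame (n x) 4) (fderiv ℝ (fun y => n y 3) x Y) : ℝ) =
      2 * inner ℝ (tangentFrame F e x 1) (fderiv ℝ (fun y => tangentFrame F e y 3) x Y) ∧
    (inner ℝ (dualFrame (n x) 1) (fderiv ℝ (fun y => n y 0) x Y) -
        inner ℝ (dualFrame (n x) 2) (fderiv ℝ (fun y => n y 3) x Y) : ℝ) =
      -2 * inner ℝ (tangentFrame F e x 2) (fderiv ℝ (fun y => tangentFrame F e y 3) x Y) := by
  have rel := connection_relations (jet h).phi_skew
    ((jet h).structureDefect_symm (jet_isIntegral h))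
  rw [h.self_of_nhds.eq_sum Y]
  simp only [map_sum, map_smul, inner_sum, real_inner_smul_right, Finset.mul_sum,
    ← Finset.sum_sub_distrib]
  refine ⟨Finset.sum_congr rfl fun l _ => ?_, Finset.sum_congr rfl fun l _ => ?_,
    Finset.sum_congr rfl fun l _ => ?_⟩
  · rw [mul_left_comm]
    exact congrArg _ (rel l).1
  · rw [mul_left_comm]
    exact congrArg _ (rel l).2.1
  · rw [mul_left_comm, ← mul_sub]
    exact congrArg _ (rel l).2.2

/-- A vector normal to the span of the frame is normal to the derivatives of the frame. -/
theorem inner_fderiv_normal_eq_zero (h : ∀ᶠ y in 𝓝 x, IsMovingFrame F e n y) {ξ : W}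
    (hξe : ∀ i, inner ℝ ξ (tangentFrame F e x i) = (0 : ℝ))
    (hξn : ∀ a, inner ℝ ξ (n x a) = (0 : ℝ)) (b : Fin 5) (l : Fin 4) :
    inner ℝ ξ (fderiv ℝ (fun y => n y b) x (e x l)) = (0 : ℝ) := by
  have hx := h.self_of_nhds
  have hξDe : ∀ i Y, (inner ℝ ξ (fderiv ℝ (fun y => tangentFrame F e y i) x Y) : ℝ) = 0 := by
    intro i Y
    rw [hx.deriv_eq i Y, inner_add_right, inner_sum, inner_sum]
    simp [real_inner_smul_right, hξe, hξn]
  -- Pairing the derivative of `de_i = φ^j_i e_j + S^a_ij ω^j n_a` with `ξ` kills every term except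
  -- those in which `n_a` is differentiated.
  have key : ∀ i (X Y : V4),
      (inner ℝ ξ (fderiv ℝ (fderiv ℝ (fun y => tangentFrame F e y i)) x X Y) : ℝ) =
      ∑ a, (∑ j, basisQB a i j * inner ℝ (tangentFrame F e x j) (fderiv ℝ F x Y)) *
        inner ℝ ξ (fderiv ℝ (fun y => n y a) x X) := by
    intro i X Y
    let p : Fin 4 → V4 → ℝ := fun j y => inner ℝ (tangentFrame F e y j)
      (fderiv ℝ (fun y => tangentFrame F e y i) y Y)
    let s : Fin 5 → V4 → ℝ := fun a y =>
      ∑ j, basisQB a i j * inner ℝ (tangentFrame F e y j) (fderiv ℝ F y Y)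
    have hF1 : DifferentiableAt ℝ (fderiv ℝ F) x :=
      (hx.contDiff.fderiv_right (m := 2) (by norm_num)).differentiableAt two_ne_zero
    have hε : ∀ j, DifferentiableAt ℝ (fun y => tangentFrame F e y j) x := fun j =>
      (hx.contDiff_tangentFrame j).differentiableAt two_ne_zero
    have hn : ∀ a, DifferentiableAt ℝ (fun y => n y a) x := fun a =>
      (hx.contDiff_n a).differentiableAt two_ne_zero
    have hp : ∀ j, DifferentiableAt ℝ (p j) x := fun j => (hε j).inner ℝ
      ((((hx.contDiff_tangentFrame i).fderiv_right (m := 1) (by norm_num)).differentiableAt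
        one_ne_zero).clm_apply (differentiableAt_const Y))
    have hs : ∀ a, DifferentiableAt ℝ (s a) x := fun a => DifferentiableAt.fun_sum fun j _ =>
      ((hε j).inner ℝ (hF1.clm_apply (differentiableAt_const Y))).const_mul _
    have hie : ∀ j, HasFDerivAt (fun y => (inner ℝ ξ (tangentFrame F e y j) : ℝ))
        ((innerSL ℝ ξ).comp (fderiv ℝ (fun y => tangentFrame F e y j) x)) x := fun j =>
      (innerSL ℝ ξ).hasFDerivAt.comp x (hε j).hasFDerivAt
    have hin : ∀ a, HasFDerivAt (fun y => (inner ℝ ξ (n y a) : ℝ))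
        ((innerSL ℝ ξ).comp (fderiv ℝ (fun y => n y a) x)) x := fun a =>
      (innerSL ℝ ξ).hasFDerivAt.comp x (hn a).hasFDerivAt
    have heq : (fun y => (inner ℝ ξ (fderiv ℝ (fun y => tangentFrame F e y i) y Y) : ℝ)) =ᶠ[𝓝 x]
        fun y => ∑ j, p j y * inner ℝ ξ (tangentFrame F e y j) +
          ∑ a, s a y * inner ℝ ξ (n y a) := by
      filter_upwards [h] with y hy
      rw [hy.deriv_eq i Y, inner_add_right, inner_sum, inner_sum]
      simp only [real_inner_smul_right, p, s]
    have hder := (HasFDerivAt.fun_sum (u := Finset.univ) fun j _ =>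
      (hp j).hasFDerivAt.mul (hie j)).add (HasFDerivAt.fun_sum (u := Finset.univ) fun a _ =>
      (hs a).hasFDerivAt.mul (hin a))
    have h' := congrArg (fun L : V4 →L[ℝ] ℝ => L X) (heq.fderiv_eq.trans hder.fderiv)
    beta_reduce at h'
    rw [fderiv_inner_fderiv contDiffAt_const (hx.contDiff_tangentFrame i)] at h'
    simpa [hξe, hξn, hξDe, s] using h'
  -- Symmetry of the second derivative of `e_i` makes `S^a_ik ⟨ξ, dn_a(e_l)⟩` symmetric in `k` and
  -- `l`, so it is an element of the vanishing first prolongation of `QB`.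
  have sym := fun i k l => (key i (e x l) (e x k)).symm.trans
    ((congrArg _ (sndDeriv_symm (hx.contDiff_tangentFrame i) _ _)).trans
      (key i (e x k) (e x l)))
  have hδ : ∀ j l, (inner ℝ (tangentFrame F e x j) (fderiv ℝ F x (e x l)) : ℝ) =
      if j = l then 1 else 0 := hx.inner_tangentFrame
  simp only [hδ, mul_ite, mul_one, mul_zero, Finset.sum_ite_eq',
    Finset.mem_univ, if_true] at sym
  exact prolongation_QB_eq_zero
    (κ := fun b l => inner ℝ ξ (fderiv ℝ (fun y => n y b) x (e x l))) sym b l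

/-- The component `ρ` of `dn_b(e_l)` orthogonal to the frame pairs to zero with `dn_b(e_l)` itself,
by `inner_fderiv_normal_eq_zero`; hence `⟨ρ, ρ⟩ = 0`. -/
theorem jet_isClosed (h : ∀ᶠ y in 𝓝 x, IsMovingFrame F e n y) : (jet h).IsClosed := by
  intro b l
  have hx := h.self_of_nhds
  set w : W := fderiv ℝ (fun y => n y b) x (e x l) with hw
  change w = ∑ a, (inner ℝ (dualFrame (n x) a) w : ℝ) • n x a +
    ∑ i, (inner ℝ (tangentFrame F e x i) w : ℝ) • tangentFrame F e x i
  set v : W := w - ∑ a, (inner ℝ (dualFrame (n x) a) w : ℝ) • n x a with hv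
  set ρ : W := v - ∑ i, (inner ℝ (tangentFrame F e x i) w : ℝ) • tangentFrame F e x i with hρ
  have hρe : ∀ i, (inner ℝ ρ (tangentFrame F e x i) : ℝ) = 0 := by
    intro i
    rw [real_inner_comm, hρ, hv]
    simp [inner_sub_right, inner_sum, real_inner_smul_right, hx.inner_e_n, hx.inner_tangentFrame]
  have hρn : ∀ a, (inner ℝ ρ (n x a) : ℝ) = 0 := by
    intro a
    rw [hρ, inner_sub_left, inner_sub_sum_dualFrame hx.linearIndependent]
    simp [sum_inner, real_inner_smul_left, hx.inner_e_n]
  have hρw : (inner ℝ ρ w : ℝ) = 0 := inner_fderiv_normal_eq_zero h hρe hρn b l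
  have hρρ : (inner ℝ ρ ρ : ℝ) = 0 := by
    conv_lhs => rw [hρ, hv]
    rw [← hv, ← hρ, inner_sub_right, inner_sub_right, hρw]
    simp [inner_sum, real_inner_smul_right, hρe, hρn]
  have h0 : ρ = 0 := inner_self_eq_zero.1 hρρ
  rw [hρ, hv, sub_sub, sub_eq_zero] at h0
  exact h0

/-- There is no moving frame with second fundamental form `S^a n_a`. -/
theorem not_eventually : ¬ ∀ᶠ y in 𝓝 x, IsMovingFrame F e n y := by
  intro h
  have hx := h.self_of_nhds
  -- The relations between connection forms hold at all nearby points, which is what permits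
  -- differentiating them.
  have hh : ∀ᶠ y in 𝓝 x, ∀ᶠ z in 𝓝 y, IsMovingFrame F e n z := h.eventually_nhds
  have dκ : ∀ a b (X Y : V4), fderiv ℝ (fun y => (inner ℝ (dualFrame (n y) a)
      (fderiv ℝ (fun y => n y b) y Y) : ℝ)) x X = _ := fun a b X Y =>
    fderiv_inner_fderiv (hx.contDiff_dual a) (hx.contDiff_n b) X Y
  have dφ : ∀ j i (X Y : V4), fderiv ℝ (fun y => (inner ℝ (tangentFrame F e y j)
      (fderiv ℝ (fun y => tangentFrame F e y i) y Y) : ℝ)) x X = _ := fun j i X Y =>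
    fderiv_inner_fderiv ((hx.contDiff_tangentFrame j).of_le one_le_two)
      (hx.contDiff_tangentFrame i) X Y
  have hdκ : ∀ a b (Y : V4), DifferentiableAt ℝ (fun y => (inner ℝ (dualFrame (n y) a)
      (fderiv ℝ (fun y => n y b) y Y) : ℝ)) x := fun a b Y =>
    ((hx.contDiff_dual a).differentiableAt one_ne_zero).inner ℝ
      ((((hx.contDiff_n b).fderiv_right (m := 1) (by norm_num)).differentiableAt
        one_ne_zero).clm_apply (differentiableAt_const Y))
  have hdφ : ∀ j i (Y : V4), DifferentiableAt ℝ (fun y => (inner ℝ (tangentFrame F e y j)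
      (fderiv ℝ (fun y => tangentFrame F e y i) y Y) : ℝ)) x := fun j i Y =>
    ((hx.contDiff_tangentFrame j).differentiableAt two_ne_zero).inner ℝ
      ((((hx.contDiff_tangentFrame i).fderiv_right (m := 1) (by norm_num)).differentiableAt
        one_ne_zero).clm_apply (differentiableAt_const Y))
  have r₁ : ∀ X Y : V4, _ := fun X Y => congrArg (fun L : V4 →L[ℝ] ℝ => L X)
    (Filter.EventuallyEq.fderiv_eq (hh.mono fun y hy => (connection_forms hy Y).1))
  have r₂ : ∀ X Y : V4, _ := fun X Y => congrArg (fun L : V4 →L[ℝ] ℝ => L X)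
    (Filter.EventuallyEq.fderiv_eq (hh.mono fun y hy => (connection_forms hy Y).2.1))
  have r₃ : ∀ X Y : V4, _ := fun X Y => congrArg (fun L : V4 →L[ℝ] ℝ => L X)
    (Filter.EventuallyEq.fderiv_eq (hh.mono fun y hy => (connection_forms hy Y).2.2))
  simp only [fderiv_const_mul (hdφ _ _ _), fderiv_fun_sub (hdκ _ _ _) (hdκ _ _ _), sub_apply,
    smul_apply, smul_eq_mul, dκ, dφ] at r₁ r₂ r₃
  have sn := fun b (X Y : V4) => sndDeriv_symm (hx.contDiff_n b) X Y
  have se := fun i (X Y : V4) => sndDeriv_symm (hx.contDiff_tangentFrame i) X Y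
  -- Each goal is the exterior derivative of a relation, obtained as the difference of its
  -- derivatives in the two orders, with second derivatives of the frame cancelling.
  refine (jet h).not_isIntegral (jet_isClosed h) (jet_isIntegral h) ?_ ?_ ?_
  · have h1 := r₁ (e x 0) (e x 2)
    have h2 := r₁ (e x 2) (e x 0)
    rw [sn 0, se 2] at h1
    simp only [jet, frameJet]
    linarith
  · have h1 := r₂ (e x 1) (e x 3)
    have h2 := r₂ (e x 3) (e x 1)
    rw [sn 3, se 3] at h1
    simp only [jet, frameJet]
    linarith
  · have h1 := r₃ (e x 2) (e x 3)
    have h2 := r₃ (e x 3) (e x 2)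
    rw [sn 0, sn 3, se 3] at h1
    simp only [jet, frameJet]
    linarith

end IsMovingFrame

end MovingFrame

/-! ### Nonexistence of adapted frames with independent normals -/

section LocalNonexistence

open scoped Topology

variable {W : Type*} [NormedAddCommGroup W] [InnerProductSpace ℝ W] {F : V4 → W} {x : V4}

/-- An explicit formula for the normal projection in a tangent orthonormal frame, from which smooth
dependence on the point can be read off. -/
theorem localII_eq_sub {c : Fin 4 → V4} (h : Orthonormal ℝ fun i => fderiv ℝ F x (c i))
    (u v : V4) : localII F x u v = fderiv ℝ (fderiv ℝ F) x u v -
      ∑ k, (inner ℝ (fderiv ℝ F x (c k)) (fderiv ℝ (fderiv ℝ F) x u v) : ℝ) •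
        fderiv ℝ F x (c k) := by
  rw [localII_apply]
  set w := fderiv ℝ (fderiv ℝ F) x u v
  have hK : ∑ k, (inner ℝ (fderiv ℝ F x (c k)) w : ℝ) • fderiv ℝ F x (c k) ∈
      LinearMap.range (fderiv ℝ F x).toLinearMap :=
    Submodule.sum_mem _ fun k _ => Submodule.smul_mem _ _ ⟨c k, rfl⟩
  refine Submodule.eq_starProjection_of_mem_orthogonal ?_ ?_
  · rw [Submodule.mem_orthogonal]
    rintro _ ⟨Y, rfl⟩
    change (inner ℝ (fderiv ℝ F x Y) _ : ℝ) = 0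
    rw [eq_sum_of_orthonormal h Y]
    simp only [map_sum, map_smul, sum_inner, real_inner_smul_left, inner_sub_right, inner_sum,
      real_inner_smul_right, orthonormal_iff_ite.1 h]
    simp [mul_comm]
  · rw [sub_sub_cancel]
    exact Submodule.le_orthogonal_orthogonal _ hK

variable {e : V4 → Fin 4 → V4}

theorem contDiffAt_localII (hF : ContDiffAt ℝ ∞ F x)
    (he : ∀ i, ContDiffAt ℝ 2 (fun y => e y i) x)
    (h : ∀ᶠ y in 𝓝 x, Orthonormal ℝ (tangentFrame F e y)) (i j : Fin 4) :
    ContDiffAt ℝ 2 (fun y => localII F y (e y i) (e y j)) x := by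
  have h1 : ContDiffAt ℝ ∞ (fderiv ℝ F) x := contDiffAt_fderiv_infty hF
  have h2 : ContDiffAt ℝ 2 (fderiv ℝ F) x := h1.of_le (WithTop.coe_le_coe.2 le_top)
  have h3 : ContDiffAt ℝ 2 (fderiv ℝ (fderiv ℝ F)) x :=
    (contDiffAt_fderiv_infty h1).of_le (WithTop.coe_le_coe.2 le_top)
  have h4 : ContDiffAt ℝ 2 (fun y => fderiv ℝ (fderiv ℝ F) y (e y i) (e y j)) x :=
    (h3.clm_apply (he i)).clm_apply (he j)
  have h5 : ∀ k, ContDiffAt ℝ 2 (fun y => fderiv ℝ F y (e y k)) x := fun k => h2.clm_apply (he k)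
  have h6 : ContDiffAt ℝ 2 (fun y => fderiv ℝ (fderiv ℝ F) y (e y i) (e y j) -
      ∑ k, (inner ℝ (fderiv ℝ F y (e y k)) (fderiv ℝ (fderiv ℝ F) y (e y i) (e y j)) : ℝ) •
        fderiv ℝ F y (e y k)) x :=
    h4.sub (ContDiffAt.sum fun k _ => ((h5 k).inner ℝ h4).smul (h5 k))
  refine h6.congr_of_eventuallyEq ?_
  filter_upwards [h] with y hy
  exact localII_eq_sub hy _ _

/-- An adapted frame with independent normals is a moving frame. -/
theorem IsAdaptedFrame.isMovingFrame (hF : ContDiffAt ℝ ∞ F x)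
    (he : ∀ i, ContDiffAt ℝ 2 (fun y => e y i) x)
    (h : ∀ᶠ y in 𝓝 x, IsAdaptedFrame F y (e y))
    (hli : LinearIndependent ℝ (frameNormals F x (e x))) :
    IsMovingFrame F e (fun y => frameNormals F y (e y)) x where
  contDiff := hF.of_le (WithTop.coe_le_coe.2 le_top)
  contDiff_e := he
  contDiff_n a := by
    have hII := contDiffAt_localII hF he (h.mono fun y hy => hy.orthonormal)
    fin_cases a <;> exact hII _ _
  orthonormal := h.self_of_nhds.orthonormal
  inner_e_n i a := inner_frameNormals F x (e x) a (e x i)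
  linearIndependent := hli
  deriv_eq i Y := by
    have hx := h.self_of_nhds
    have hd : DifferentiableAt ℝ (fderiv ℝ F) x :=
      (contDiffAt_fderiv_infty hF).differentiableAt (by simp)
    have he' : DifferentiableAt ℝ (fun y => e y i) x := (he i).differentiableAt two_ne_zero
    -- The term from differentiating `e` in the chart is tangent, so the normal part of `de_i(Y)` is
    -- `II(Y, e_i)`.
    have hD : fderiv ℝ (fun y => tangentFrame F e y i) x Y =
        fderiv ℝ (fderiv ℝ F) x Y (e x i) +
          fderiv ℝ F x (fderiv ℝ (fun y => e y i) x Y) := by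
      change fderiv ℝ (fun y => fderiv ℝ F y (e y i)) x Y = _
      rw [fderiv_clm_apply hd he']
      simp [add_comm]
    have hII : localII F x Y (e x i) =
        ∑ a, (∑ j, basisQB a i j * inner ℝ (tangentFrame F e x j) (fderiv ℝ F x Y)) •
          frameNormals F x (e x) a := by
      conv_lhs => rw [eq_sum_of_orthonormal hx.orthonormal Y]
      rw [localII_symm hF]
      simp only [map_sum, map_smul, hx.II_eq hF, Finset.smul_sum, Finset.sum_smul, smul_smul]
      rw [Finset.sum_comm]
      refine Finset.sum_congr rfl fun a _ => Finset.sum_congr rfl fun j _ => ?_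
      rw [mul_comm]
      rfl
    have hsub := localII_eq_sub hx.orthonormal Y (e x i)
    have hY := congrArg (fderiv ℝ F x)
      (eq_sum_of_orthonormal hx.orthonormal (fderiv ℝ (fun y => e y i) x Y))
    rw [map_sum] at hY
    simp only [map_smul] at hY
    rw [← hII, hsub, hD]
    simp only [inner_add_right, add_smul, Finset.sum_add_distrib]
    conv_lhs => rw [hY]
    change _ = ∑ k, _ + ∑ k, _ + _
    simp only [tangentFrame]
    abel

/-- An immersion does not admit adapted frames with independent normals on an open set. -/
theorem not_linearIndependent_frameNormals (hF : ∀ᶠ y in 𝓝 x, ContDiffAt ℝ ∞ F y)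
    (h : ∀ᶠ y in 𝓝 x, ∃ c, IsAdaptedFrame F y c) {c : Fin 4 → V4} (hc : IsAdaptedFrame F x c) :
    ¬ LinearIndependent ℝ (frameNormals F x c) := by
  intro hli
  obtain ⟨e, he, rfl, hea⟩ := exists_smooth_adaptedFrame hF h hc hli
  have he2 : ∀ i, ContDiffAt ℝ 2 (fun y => e y i) x := fun i =>
    (he i).of_le (WithTop.coe_le_coe.2 le_top)
  have hn : ∀ᶠ y in 𝓝 x, LinearIndependent ℝ (frameNormals F y (e y)) :=
    eventually_linearIndependent (n := fun y => frameNormals F y (e y)) (fun a =>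
      ((IsAdaptedFrame.isMovingFrame hF.self_of_nhds he2 hea hli).contDiff_n a).continuousAt) hli
  have he2' : ∀ᶠ y in 𝓝 x, ∀ i, ContDiffAt ℝ 2 (fun z => e z i) y :=
    Filter.eventually_all.2 fun i => (he2 i).eventually (by simp)
  refine IsMovingFrame.not_eventually (F := F) (e := e) (n := fun y => frameNormals F y (e y))
    (x := x) ?_
  filter_upwards [hF, he2', hea.eventually_nhds, hn] with y hFy hey hy hny
  exact IsAdaptedFrame.isMovingFrame hFy hey hy hny

end LocalNonexistence

/-! ### Immersed manifolds in coordinates -/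

section Coordinates

open scoped Topology

/-! ### Behaviour of the second fundamental form under change of coordinates -/

section Pullback

variable {W : Type*} [NormedAddCommGroup W] [InnerProductSpace ℝ W] {F G : V4 → W}
  {τ : V4 → V4} {y : V4}

theorem fderiv_comp_of_eventuallyEq (hF : ContDiffAt ℝ ∞ F (τ y)) (hτ : ContDiffAt ℝ ∞ τ y)
    (hG : G =ᶠ[𝓝 y] F ∘ τ) (v : V4) :
    fderiv ℝ G y v = fderiv ℝ F (τ y) (fderiv ℝ τ y v) := by
  rw [hG.fderiv_eq, fderiv_comp y (hF.differentiableAt (by simp)) (hτ.differentiableAt (by simp))]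
  rfl

theorem sndDeriv_comp_of_eventuallyEq (hF : ContDiffAt ℝ ∞ F (τ y)) (hτ : ContDiffAt ℝ ∞ τ y)
    (hG : G =ᶠ[𝓝 y] F ∘ τ) (u v : V4) :
    fderiv ℝ (fderiv ℝ G) y u v =
      fderiv ℝ (fderiv ℝ F) (τ y) (fderiv ℝ τ y u) (fderiv ℝ τ y v) +
        fderiv ℝ F (τ y) (fderiv ℝ (fderiv ℝ τ) y u v) := by
  have hτ' := (contDiffAt_fderiv_infty hτ).differentiableAt (by simp)
  have hF' := (contDiffAt_fderiv_infty hF).differentiableAt (by simp)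
  have hτ1 : DifferentiableAt ℝ τ y := hτ.differentiableAt (by simp)
  have hF1 : ∀ᶠ z in 𝓝 y, DifferentiableAt ℝ F (τ z) := by
    have h1 : ∀ᶠ w in 𝓝 (τ y), ContDiffAt ℝ 1 F w :=
      (hF.of_le (WithTop.coe_le_coe.2 le_top)).eventually (by simp)
    exact (hτ.continuousAt.eventually h1).mono fun z hz => hz.differentiableAt one_ne_zero
  have hτ2 : ∀ᶠ z in 𝓝 y, DifferentiableAt ℝ τ z := by
    have h1 : ∀ᶠ w in 𝓝 y, ContDiffAt ℝ 1 τ w :=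
      (hτ.of_le (WithTop.coe_le_coe.2 le_top)).eventually (by simp)
    exact h1.mono fun z hz => hz.differentiableAt one_ne_zero
  have heq : fderiv ℝ G =ᶠ[𝓝 y] fun z => (fderiv ℝ F (τ z)).comp (fderiv ℝ τ z) := by
    filter_upwards [hG.fderiv (𝕜 := ℝ), hF1, hτ2] with z hz h1 h2
    rw [hz, fderiv_comp z h1 h2]
  have hF'' : HasFDerivAt (fun z => fderiv ℝ F (τ z))
      ((fderiv ℝ (fderiv ℝ F) (τ y)).comp (fderiv ℝ τ y)) y :=
    hF'.hasFDerivAt.comp y hτ1.hasFDerivAt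
  rw [heq.fderiv_eq, (hF''.clm_comp hτ'.hasFDerivAt).fderiv]
  simp [add_comm]

/-- Injectivity of `DG` makes `Dτ` injective, hence bijective in dimension 4. -/
theorem range_fderiv_comp (hF : ContDiffAt ℝ ∞ F (τ y)) (hτ : ContDiffAt ℝ ∞ τ y)
    (hG : G =ᶠ[𝓝 y] F ∘ τ) (hinj : Function.Injective (fderiv ℝ G y)) :
    LinearMap.range (fderiv ℝ G y).toLinearMap =
      LinearMap.range (fderiv ℝ F (τ y)).toLinearMap := by
  have hc := fderiv_comp_of_eventuallyEq hF hτ hG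
  have hi : Function.Injective (fderiv ℝ τ y).toLinearMap := fun u v huv => hinj (by
    rw [hc, hc]
    exact congrArg _ huv)
  have hs := LinearMap.injective_iff_surjective.1 hi
  refine le_antisymm ?_ ?_
  · rintro _ ⟨v, rfl⟩
    exact ⟨fderiv ℝ τ y v, (hc v).symm⟩
  · rintro _ ⟨v, rfl⟩
    obtain ⟨u, rfl⟩ := hs v
    exact ⟨u, hc u⟩

/-- Tensoriality: the extra chain-rule term `DF(D²τ(u, v))` is tangent, so the normal projection
removes it. -/
theorem localII_comp (hF : ContDiffAt ℝ ∞ F (τ y)) (hτ : ContDiffAt ℝ ∞ τ y)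
    (hG : G =ᶠ[𝓝 y] F ∘ τ) (hinj : Function.Injective (fderiv ℝ G y)) (u v : V4) :
    localII G y u v = localII F (τ y) (fderiv ℝ τ y u) (fderiv ℝ τ y v) := by
  simp only [localII_apply, range_fderiv_comp hF hτ hG hinj]
  rw [sndDeriv_comp_of_eventuallyEq hF hτ hG, map_add]
  exact add_eq_left.2 ((Submodule.starProjection_apply_eq_zero_iff _).2
    (Submodule.le_orthogonal_orthogonal _ ⟨_, rfl⟩))

theorem IsAdaptedFrame.map {c : Fin 4 → V4} (h : IsAdaptedFrame G y c)
    (hF : ContDiffAt ℝ ∞ F (τ y)) (hτ : ContDiffAt ℝ ∞ τ y)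
    (hG : G =ᶠ[𝓝 y] F ∘ τ) (hinj : Function.Injective (fderiv ℝ G y)) :
    IsAdaptedFrame F (τ y) fun i => fderiv ℝ τ y (c i) := by
  have hII := localII_comp hF hτ hG hinj
  refine ⟨?_, ?_, ?_, ?_, ?_, ?_⟩
  · simpa only [fderiv_comp_of_eventuallyEq hF hτ hG] using h.orthonormal
  · simpa only [hII] using h.II_01
  · simpa only [hII] using h.II_23
  · simpa only [hII] using h.II_11
  · simpa only [hII] using h.II_22
  · simpa only [hII] using h.II_33

/-- The values of `II` are normal, so linear relations between them may be tested against normal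
vectors, where they are the entries of a matrix in `QB`. -/
theorem isAdaptedFrame_of_mem_QB {x : V4} {c : Fin 4 → V4}
    (ho : Orthonormal ℝ fun i => fderiv ℝ F x (c i))
    (h : ∀ ν ∈ (LinearMap.range (fderiv ℝ F x).toLinearMap)ᗮ,
      Matrix.of (fun i j => (inner ℝ ν (localII F x (c i) (c j)) : ℝ)) ∈ QB) :
    IsAdaptedFrame F x c := by
  have hz : ∀ v ∈ (LinearMap.range (fderiv ℝ F x).toLinearMap)ᗮ,
      (∀ ν ∈ (LinearMap.range (fderiv ℝ F x).toLinearMap)ᗮ, inner ℝ ν v = (0 : ℝ)) → v = 0 :=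
    fun v hv hν => inner_self_eq_zero.1 (hν v hv)
  have hm := fun i j => localII_mem F x (c i) (c j)
  have entry : ∀ ν ∈ (LinearMap.range (fderiv ℝ F x).toLinearMap)ᗮ,
      inner ℝ ν (localII F x (c 0) (c 1)) = (0 : ℝ) ∧
      inner ℝ ν (localII F x (c 2) (c 3)) = (0 : ℝ) ∧
      (inner ℝ ν (localII F x (c 1) (c 1)) : ℝ) = inner ℝ ν (localII F x (c 0) (c 0)) ∧
      (inner ℝ ν (localII F x (c 2) (c 2)) : ℝ) = -inner ℝ ν (localII F x (c 0) (c 0)) ∧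
      (inner ℝ ν (localII F x (c 3) (c 3)) : ℝ) = -inner ℝ ν (localII F x (c 0) (c 0)) := by
    intro ν hν
    obtain ⟨m, B, hB⟩ := h ν hν
    have hij := fun i j => congrFun (congrFun hB i) j
    have h00 := hij 0 0
    have h01 := hij 0 1
    have h23 := hij 2 3
    have h11 := hij 1 1
    have h22 := hij 2 2
    have h33 := hij 3 3
    simp at h00 h01 h23 h11 h22 h33
    exact ⟨h01, h23, h11.trans h00.symm, by rw [h22, h00], by rw [h33, h00]⟩
  refine ⟨ho, hz _ (hm 0 1) fun ν hν => (entry ν hν).1, hz _ (hm 2 3) fun ν hν => (entry ν hν).2.1,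
    ?_, ?_, ?_⟩
  · refine sub_eq_zero.1 (hz _ (Submodule.sub_mem _ (hm 1 1) (hm 0 0)) fun ν hν => ?_)
    rw [inner_sub_right, (entry ν hν).2.2.1, sub_self]
  · refine eq_neg_of_add_eq_zero_left (hz _ (Submodule.add_mem _ (hm 2 2) (hm 0 0)) fun ν hν => ?_)
    rw [inner_add_right, (entry ν hν).2.2.2.1, neg_add_cancel]
  · refine eq_neg_of_add_eq_zero_left (hz _ (Submodule.add_mem _ (hm 3 3) (hm 0 0)) fun ν hν => ?_)
    rw [inner_add_right, (entry ν hν).2.2.2.2, neg_add_cancel]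

theorem IsAdaptedFrame.span_localII {x : V4} {c : Fin 4 → V4} (h : IsAdaptedFrame F x c)
    (hF : ContDiffAt ℝ ∞ F x) (u v : V4) :
    localII F x u v ∈ Submodule.span ℝ (Set.range (frameNormals F x c)) := by
  rw [eq_sum_of_orthonormal h.orthonormal u, eq_sum_of_orthonormal h.orthonormal v]
  simp only [map_sum, map_smul, sum_apply, smul_apply, h.II_eq hF]
  exact Submodule.sum_mem _ fun i _ => Submodule.smul_mem _ _ <| Submodule.sum_mem _ fun j _ =>
    Submodule.smul_mem _ _ <| Submodule.sum_mem _ fun a _ =>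
      Submodule.smul_mem _ _ (Submodule.subset_span ⟨a, rfl⟩)

end Pullback

/-! ### Transfer from the manifold to a fixed chart -/

variable {r : ℕ} {M : Type*} [TopologicalSpace M] [ChartedSpace V4 M]
  {f : M → EuclideanSpace ℝ (Fin (4 + r))}

/-- The map `f` in the preferred coordinates at `p`. -/
def coordMap (f : M → EuclideanSpace ℝ (Fin (4 + r))) (p : M) :
    V4 → EuclideanSpace ℝ (Fin (4 + r)) :=
  f ∘ (extChartAt (𝓡 4) p).symm

theorem contDiffAt_coordMap [IsManifold (𝓡 4) ∞ M] (hf : IsSmoothImmersion f) (p : M) {x : V4}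
    (hx : x ∈ (extChartAt (𝓡 4) p).target) : ContDiffAt ℝ ∞ (coordMap f p) x := by
  rw [← contMDiffAt_iff_contDiffAt]
  have h1 := (contMDiffOn_extChartAt_symm (I := 𝓡 4) (n := ∞) p).contMDiffAt
    ((isOpen_extChartAt_target p).mem_nhds hx)
  exact (hf.1 _).comp x h1

theorem diff_eq_fderiv [IsManifold (𝓡 4) ∞ M] (hf : IsSmoothImmersion f) (p : M) :
    diff f p = fderiv ℝ (coordMap f p) (extChartAt (𝓡 4) p p) := by
  have h := ((hf.1 p).mdifferentiableAt (by simp)).mfderiv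
  simp only [modelWithCornersSelf_coe, Set.range_id, fderivWithin_univ] at h
  exact h

theorem secondFundamentalForm_eq [IsManifold (𝓡 4) ∞ M] (hf : IsSmoothImmersion f) (p : M)
    (X Y : V4) : secondFundamentalForm f p X Y =
      localII (coordMap f p) (extChartAt (𝓡 4) p p) X Y := by
  rw [localII_apply, ← diff_eq_fderiv hf]
  rfl

theorem exists_isAdaptedFrame_self [IsManifold (𝓡 4) ∞ M] (hf : IsSmoothImmersion f)
    (hB : IsTypeB f) (p : M) :
    ∃ c, IsAdaptedFrame (coordMap f p) (extChartAt (𝓡 4) p p) c := by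
  obtain ⟨e, he, hQ⟩ := hB p
  refine ⟨e, isAdaptedFrame_of_mem_QB ?_ fun ν hν => ?_⟩
  · rw [← diff_eq_fderiv hf]
    exact he
  · rw [← diff_eq_fderiv hf] at hν
    have := hQ ν hν
    simp only [formMatrix] at this
    convert this using 5 with i j
    exact (secondFundamentalForm_eq hf p _ _).symm

/-- Type B at `q` is read in the preferred chart at `q`, while the local argument needs one chart
for a whole neighbourhood. The transition map `τ` carries the adapted frame from the chart at `q` to
the chart at `p`. -/
theorem exists_isAdaptedFrame [IsManifold (𝓡 4) ∞ M] (hf : IsSmoothImmersion f)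
    (hB : IsTypeB f) (p : M) {x : V4} (hx : x ∈ (extChartAt (𝓡 4) p).target) :
    ∃ c, IsAdaptedFrame (coordMap f p) x c := by
  set q : M := (extChartAt (𝓡 4) p).symm x with hq
  have hqs : q ∈ (extChartAt (𝓡 4) p).source := (extChartAt (𝓡 4) p).map_target hx
  obtain ⟨c, hc⟩ := exists_isAdaptedFrame_self hf hB q
  let τ : V4 → V4 := extChartAt (𝓡 4) p ∘ (extChartAt (𝓡 4) q).symm
  have hτy : τ (extChartAt (𝓡 4) q q) = x := by
    simp only [τ, Function.comp_apply, extChartAt_to_inv]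
    exact (extChartAt (𝓡 4) p).right_inv hx
  have hτ : ContDiffAt ℝ ∞ τ (extChartAt (𝓡 4) q q) := by
    have := contDiffWithinAt_ext_coord_change (I := 𝓡 4) (n := ∞) p q
      (y := extChartAt (𝓡 4) q q) (by
        rw [PartialEquiv.trans_source, PartialEquiv.symm_source]
        exact ⟨mem_extChartAt_target q, by simpa using hqs⟩)
    simpa only [modelWithCornersSelf_coe, Set.range_id, contDiffWithinAt_univ] using this
  have hG : coordMap f q =ᶠ[𝓝 (extChartAt (𝓡 4) q q)] coordMap f p ∘ τ := by
    have hc : ContinuousAt (extChartAt (𝓡 4) q).symm (extChartAt (𝓡 4) q q) :=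
      continuousAt_extChartAt_symm q
    have hs : ∀ᶠ z in 𝓝 ((extChartAt (𝓡 4) q).symm (extChartAt (𝓡 4) q q)),
        z ∈ (extChartAt (𝓡 4) p).source := by
      rw [extChartAt_to_inv]
      exact (isOpen_extChartAt_source p).mem_nhds hqs
    filter_upwards [hc.eventually hs] with z hz
    simp only [coordMap, τ, Function.comp_apply]
    rw [(extChartAt (𝓡 4) p).left_inv hz]
  have hinj : Function.Injective (fderiv ℝ (coordMap f q) (extChartAt (𝓡 4) q q)) := by
    rw [← diff_eq_fderiv hf]
    exact hf.2 q
  have hF : ContDiffAt ℝ ∞ (coordMap f p) (τ (extChartAt (𝓡 4) q q)) := by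
    rw [hτy]
    exact contDiffAt_coordMap hf p hx
  have hmap := hc.map hF hτ hG hinj
  rw [hτy] at hmap
  exact ⟨_, hmap⟩

/-- There are no austere `4`-folds of maximal type B. -/
theorem normalRank_ne_five [IsManifold (𝓡 4) ∞ M] (hf : IsSmoothImmersion f) (hB : IsTypeB f)
    (p : M) : normalRank f p ≠ 5 := by
  intro h5
  have ht := (isOpen_extChartAt_target (I := 𝓡 4) p).mem_nhds (mem_extChartAt_target p)
  have hF : ∀ᶠ x in 𝓝 (extChartAt (𝓡 4) p p), ContDiffAt ℝ ∞ (coordMap f p) x := by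
    filter_upwards [ht] with x hx using contDiffAt_coordMap hf p hx
  have ha : ∀ᶠ x in 𝓝 (extChartAt (𝓡 4) p p), ∃ c, IsAdaptedFrame (coordMap f p) x c := by
    filter_upwards [ht] with x hx using exists_isAdaptedFrame hf hB p hx
  obtain ⟨c, hc⟩ := ha.self_of_nhds
  refine not_linearIndependent_frameNormals hF ha hc ?_
  -- The five frame normals span the first normal space, so dimension 5 makes them independent,
  -- which the local theorem excludes.
  rw [linearIndependent_iff_card_le_finrank_span, Fintype.card_fin]
  refine h5.symm.le.trans (Submodule.finrank_mono (Submodule.span_le.2 ?_))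
  rintro _ ⟨X, Y, rfl⟩
  have hXY := secondFundamentalForm_eq hf p X Y
  exact hXY ▸ hc.span_localII hF.self_of_nhds _ _

end Coordinates

end Austere

end

theorem mainTheorem3 :
    (∀ (r : ℕ) (M : Type*) [TopologicalSpace M] [ChartedSpace Austere.V4 M]
        [IsManifold (𝓡 4) ∞ M] (f : M → EuclideanSpace ℝ (Fin (4 + r))),
        Austere.IsSmoothImmersion f → Austere.IsAustere f → Austere.IsTypeB f →
          ∀ p : M, Austere.normalRank f p ≠ 5) ∧
    (∀ u ∈ Austere.semiOrthonormalFrames, ∀ E : Submodule ℝ Austere.FrameSpace,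
        ¬ Austere.IsAdmissibleIntegralElement Austere.prolongedSystem u E) := by
  exact ⟨fun _ _ _ _ _ _ hf _ hB p => Austere.normalRank_ne_five hf hB p,
    fun _ hu E => Austere.not_isAdmissibleIntegralElement_prolongedSystem hu E⟩
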